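/- Let $A$ be a countable set with a dense linear order without smallest or greatest element (and $A\neq\emptyset$), and let $\mathcal{M}$ be the universe of set theory with set of atoms $A$ (constructed, with the axiom of choice available, as the cumulative hierarchy over $A$). Let $\mathcal{G}$ be the group of all order-preserving permutations of $A$, acting on $\mathcal{M}$ by $\pi x=\{\pi y:y\in x\}$ for sets $x$. An object $x$ of $\mathcal{M}$ is called symmetric if there is a finite set $E\subseteq A$ such that every $\pi\in\mathcal{G}$ which fixes each element of $E$ satisfies $\pi x=x$. The ordered Mostowski model $\mathcal{V}_M$ is the class of all hereditarily symmetric objects of $\mathcal{M}$, that is, of all symmetric objects whose elements, elements of elements, and so on, are all symmetric; it is considered with the membership relation of $\mathcal{M}$. For a set $m$ with cardinality $\mathfrak{m}$, let $\mathrm{Fin}(\mathfrak{m})$, $2^{\mathfrak{m}}$, $\mathrm{Seq}(\mathfrak{m})$ and $\mathrm{seq}(\mathfrak{m})$ be the cardinalities of, respectively, the set of all finite subsets of $m$, the power-set of $m$, the set of all finite one-to-one sequences of elements of $m$ (no element occurs twice), and the set of all finite sequences of elements of $m$. For cardinalities $\mathfrak{p},\mathfrak{q}$ of sets $x,y$,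 write $\mathfrak{p}\le\mathfrak{q}$ if there is a one-to-one function from $x$ into $y$, $\mathfrak{p}=\mathfrak{q}$ if there is a one-to-one function from $x$ onto $y$, and $\mathfrak{p}<\mathfrak{q}$ if $\mathfrak{p}\le\mathfrak{q}$ and $\mathfrak{p}\ne\mathfrak{q}$. Let $\mathfrak{m}$ be the cardinality of the set $A$ of atoms of $\mathcal{V}_M$. Then, with all notions interpreted in $\mathcal{V}_M$ (so that only sets and functions belonging to $\mathcal{V}_M$ are considered), the following holds in $\mathcal{V}_M$: $$\mathfrak{m}<\mathrm{Fin}(\mathfrak{m})<2^{\mathfrak{m}}<\mathrm{Seq}(\mathfrak{m})<\mathrm{seq}(\mathfrak{m}).$$ -/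

import Mathlib

universe u

/-! ### The universe of sets over a set of atoms

`ZFAPre A` are (non-extensional) codes: a code is an atom from `A`, or a small family of codes.
`ZFA A` is the quotient by extensional equality, i.e. the full cumulative hierarchy `P^∞(A)` over
the set `A` of atoms; it is built in the same way as Mathlib builds `ZFSet` out of `PSet`. -/

inductive ZFAPre (A : Type u) : Type (u + 1)
  | atom (a : A) : ZFAPre A
  | mk (ι : Type u) (f : ι → ZFAPre A) : ZFAPre A

namespace ZFAPre

variable {A : Type u}

/-- Extensional equality: atoms are equal only to themselves, families are equal if they have the
same members; an atom is never equal to a family (in particular not to the empty one). -/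
def Ext : ZFAPre A → ZFAPre A → Prop
  | atom a, atom b => a = b
  | atom _, mk _ _ => False
  | mk _ _, atom _ => False
  | mk _ f, mk _ g => (∀ i, ∃ j, Ext (f i) (g j)) ∧ (∀ j, ∃ i, Ext (f i) (g j))

theorem Ext.refl : ∀ x : ZFAPre A, Ext x x
  | atom _ => rfl
  | mk _ f => ⟨fun i => ⟨i, Ext.refl (f i)⟩, fun i => ⟨i, Ext.refl (f i)⟩⟩

theorem Ext.symm : ∀ {x y : ZFAPre A}, Ext x y → Ext y x
  | atom _, atom _, h => Eq.symm h
  | atom _, mk _ _, h => h.elim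
  | mk _ _, atom _, h => h.elim
  | mk _ _, mk _ _, ⟨h₁, h₂⟩ =>
    ⟨fun j => let ⟨i, h⟩ := h₂ j; ⟨i, Ext.symm h⟩, fun i => let ⟨j, h⟩ := h₁ i; ⟨j, Ext.symm h⟩⟩

theorem Ext.trans : ∀ {x y z : ZFAPre A}, Ext x y → Ext y z → Ext x z
  | atom _, atom _, atom _, h, k => Eq.trans h k
  | atom _, atom _, mk _ _, _, k => k.elim
  | atom _, mk _ _, _, h, _ => h.elim
  | mk _ _, atom _, _, h, _ => h.elim
  | mk _ _, mk _ _, atom _, _, k => k.elim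
  | mk _ _, mk _ _, mk _ _, ⟨h₁, h₂⟩, ⟨k₁, k₂⟩ =>
    ⟨fun i => let ⟨j, h⟩ := h₁ i; let ⟨l, k⟩ := k₁ j; ⟨l, Ext.trans h k⟩,
     fun l => let ⟨j, k⟩ := k₂ l; let ⟨i, h⟩ := h₂ j; ⟨i, Ext.trans h k⟩⟩

instance setoid (A : Type u) : Setoid (ZFAPre A) := ⟨Ext, Ext.refl, Ext.symm, Ext.trans⟩

/-- `x` is a member of `y`; atoms have no members. -/
def Mem (x : ZFAPre A) : ZFAPre A → Prop
  | atom _ => False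
  | mk _ f => ∃ i, Ext x (f i)

theorem Mem.congr {x x' y y' : ZFAPre A} (hx : Ext x x') (hy : Ext y y') :
    Mem x y → Mem x' y' := by
  cases y with
  | atom a => exact fun h => h.elim
  | mk ι f =>
    cases y' with
    | atom b => exact hy.elim
    | mk κ g =>
      rintro ⟨i, hi⟩
      obtain ⟨j, hj⟩ := hy.1 i
      exact ⟨j, hx.symm.trans (hi.trans hj)⟩

/-- `x` is an atom. -/
def IsAtom : ZFAPre A → Prop
  | atom _ => True
  | mk _ _ => False

theorem IsAtom.congr {x y : ZFAPre A} (h : Ext x y) : IsAtom x → IsAtom y := by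
  cases x <;> cases y <;> simp_all [IsAtom, Ext]

/-- The action of a permutation of the atoms on codes. -/
def act (π : Equiv.Perm A) : ZFAPre A → ZFAPre A
  | atom a => atom (π a)
  | mk ι f => mk ι fun i => act π (f i)

theorem act_congr (π : Equiv.Perm A) : ∀ {x y : ZFAPre A}, Ext x y → Ext (act π x) (act π y)
  | atom _, atom _, h => congrArg π h
  | atom _, mk _ _, h => h.elim
  | mk _ _, atom _, h => h.elim
  | mk _ _, mk _ _, ⟨h₁, h₂⟩ =>
    ⟨fun i => let ⟨j, h⟩ := h₁ i; ⟨j, act_congr π h⟩,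
     fun j => let ⟨i, h⟩ := h₂ j; ⟨i, act_congr π h⟩⟩

theorem act_one : ∀ x : ZFAPre A, act 1 x = x
  | atom _ => rfl
  | mk ι f => congrArg (mk ι) (funext fun i => act_one (f i))

theorem act_mul (π σ : Equiv.Perm A) : ∀ x : ZFAPre A, act (π * σ) x = act π (act σ x)
  | atom _ => rfl
  | mk ι f => congrArg (mk ι) (funext fun i => act_mul π σ (f i))

end ZFAPre

/-- The universe of set theory with set of atoms `A`. -/
def ZFA (A : Type u) : Type (u + 1) := Quotient (ZFAPre.setoid A)

namespace ZFA

variable {A : Type u}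

instance : Membership (ZFA A) (ZFA A) where
  mem y x := Quotient.liftOn₂ x y ZFAPre.Mem fun _ _ _ _ hx hy =>
    propext ⟨ZFAPre.Mem.congr hx hy, ZFAPre.Mem.congr hx.symm hy.symm⟩

/-- `x` is an atom; the other objects are the sets. -/
def IsAtom (x : ZFA A) : Prop :=
  Quotient.liftOn x ZFAPre.IsAtom fun _ _ h =>
    propext ⟨ZFAPre.IsAtom.congr h, ZFAPre.IsAtom.congr h.symm⟩

/-- Every permutation `π` of the atoms acts on the universe, by `π x = {π y : y ∈ x}` on sets. -/
instance : MulAction (Equiv.Perm A) (ZFA A) where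
  smul π x := Quotient.map (ZFAPre.act π) (fun _ _ h => ZFAPre.act_congr π h) x
  one_smul x := Quotient.inductionOn x fun y =>
    congrArg (Quotient.mk (ZFAPre.setoid A)) (ZFAPre.act_one y)
  mul_smul π σ x := Quotient.inductionOn x fun y =>
    congrArg (Quotient.mk (ZFAPre.setoid A)) (ZFAPre.act_mul π σ y)

/-- For a group `G` of permutations of the atoms and the ideal of finite sets of atoms:
`x` is symmetric if it has a finite support `E`, that is, `Fix_G(E) ⊆ Sym_G(x)`. -/
def IsSymmetric (G : Subgroup (Equiv.Perm A)) (x : ZFA A) : Prop :=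
  ∃ E : Set A, E.Finite ∧ fixingSubgroup G E ≤ MulAction.stabilizer G x

/-- `x` is hereditarily symmetric: `x`, its members, the members of its members, and so on, are
all symmetric. -/
inductive HereditarilySymmetric (G : Subgroup (Equiv.Perm A)) : ZFA A → Prop
  | intro (x : ZFA A) (symm : IsSymmetric G x)
      (mem : ∀ y, y ∈ x → HereditarilySymmetric G y) : HereditarilySymmetric G x

end ZFA

/-- The permutation model given by the group `G` and the ideal of finite sets of atoms: the class of
all hereditarily symmetric objects, with the membership relation of the universe. -/
def PermModel {A : Type u} (G : Subgroup (Equiv.Perm A)) : Type (u + 1) :=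
  {x : ZFA A // ZFA.HereditarilySymmetric G x}

/-! ### Set-theoretic notions inside a permutation model

In what follows all quantifiers range over the elements of the model, so that `Notion x` says that
the model satisfies the formula expressing the notion. -/

namespace PermModel

variable {A : Type u} {G : Subgroup (Equiv.Perm A)}

instance : Membership (PermModel G) (PermModel G) where
  mem y x := x.1 ∈ y.1

def IsAtom (x : PermModel G) : Prop := x.1.IsAtom

def IsSet (x : PermModel G) : Prop := ¬ x.IsAtom

/-- `a` is the set of all atoms. -/
def IsAtomSet (a : PermModel G) : Prop := IsSet a ∧ ∀ x, x ∈ a ↔ IsAtom x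

/-- `x` is a set and `x ⊆ y`. -/
def IsSubset (x y : PermModel G) : Prop := IsSet x ∧ ∀ z, z ∈ x → z ∈ y

/-- `z = {x, y}`. -/
def IsUPair (z x y : PermModel G) : Prop := IsSet z ∧ ∀ w, w ∈ z ↔ w = x ∨ w = y

/-- `p = ⟨x, y⟩ = {{x}, {x, y}}`. -/
def IsOPair (p x y : PermModel G) : Prop :=
  IsSet p ∧ ∀ w, w ∈ p ↔ IsUPair w x x ∨ IsUPair w x y

/-- `f` is a function from `x` into `y` (a set of ordered pairs). -/
def IsFunction (f x y : PermModel G) : Prop :=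
  IsSet f ∧ (∀ p, p ∈ f → ∃ u v, u ∈ x ∧ v ∈ y ∧ IsOPair p u v) ∧
    ∀ u, u ∈ x → ∃! v, ∃ p, p ∈ f ∧ IsOPair p u v

/-- `f` is a one-to-one function from `x` into `y`. -/
def IsInjection (f x y : PermModel G) : Prop :=
  IsFunction f x y ∧
    ∀ u u' v p p', p ∈ f → p' ∈ f → IsOPair p u v → IsOPair p' u' v → u = u'

/-- `f` is a one-to-one function from `x` onto `y`. -/
def IsBijection (f x y : PermModel G) : Prop :=
  IsInjection f x y ∧ ∀ v, v ∈ y → ∃ u p, p ∈ f ∧ IsOPair p u v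

/-- The cardinality of `x` is less than or equal to the cardinality of `y`. -/
def CardLE (x y : PermModel G) : Prop := ∃ f, IsInjection f x y

/-- `x` and `y` have the same cardinality. -/
def CardEq (x y : PermModel G) : Prop := ∃ f, IsBijection f x y

/-- The cardinality of `x` is strictly smaller than the cardinality of `y`. -/
def CardLT (x y : PermModel G) : Prop := CardLE x y ∧ ¬ CardEq x y

/-- `α` is an ordinal: a set of sets, every element of which is a subset of `α`, and which is
(strictly) well-ordered by `∈`. -/
def IsOrdinal (α : PermModel G) : Prop :=
  IsSet α ∧ (∀ x, x ∈ α → IsSubset x α) ∧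
    (∀ x, x ∈ α → x ∉ x) ∧
    (∀ x y z, x ∈ α → y ∈ α → z ∈ α → x ∈ y → y ∈ z → x ∈ z) ∧
    (∀ x y, x ∈ α → y ∈ α → x ∈ y ∨ x = y ∨ y ∈ x) ∧
    ∀ s, IsSubset s α → (∃ x, x ∈ s) → ∃ x, x ∈ s ∧ ∀ y, y ∈ s → x = y ∨ x ∈ y

/-- `β = α ∪ {α}`. -/
def IsSucc (β α : PermModel G) : Prop := IsSet β ∧ ∀ z, z ∈ β ↔ z ∈ α ∨ z = α

/-- `n` is a natural number, i.e. a finite ordinal: `n` is an ordinal, and each of `n` and its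
elements is either empty or a successor ordinal. -/
def IsNat (n : PermModel G) : Prop :=
  IsOrdinal n ∧ ∀ k, k = n ∨ k ∈ n → (∀ z, z ∉ k) ∨ ∃ j, IsOrdinal j ∧ IsSucc k j

/-- `x` is finite: it has the cardinality of a natural number. -/
def IsFinite (x : PermModel G) : Prop := ∃ n, IsNat n ∧ CardEq n x

/-- `F = Fin(m)`, the set of all finite subsets of `m`. -/
def IsFin (F m : PermModel G) : Prop := IsSet F ∧ ∀ x, x ∈ F ↔ IsSubset x m ∧ IsFinite x

/-- `P` is the power-set of `m`. -/
def IsPowerset (P m : PermModel G) : Prop := IsSet P ∧ ∀ x, x ∈ P ↔ IsSubset x m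

/-- `S` is the set of all finite one-to-one sequences of `m`; a finite sequence of `m` is a function
from a natural number into `m`. -/
def IsInjSeq (S m : PermModel G) : Prop :=
  IsSet S ∧ ∀ s, s ∈ S ↔ ∃ n, IsNat n ∧ IsInjection s n m

/-- `S` is the set of all finite sequences of `m`. -/
def IsSeq (S m : PermModel G) : Prop :=
  IsSet S ∧ ∀ s, s ∈ S ↔ ∃ n, IsNat n ∧ IsFunction s n m

end PermModel

/-- The group of all order-preserving permutations of a linearly ordered set. -/
def orderPermGroup (A : Type u) [LinearOrder A] : Subgroup (Equiv.Perm A) where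
  carrier := {π | ∀ a b, π a < π b ↔ a < b}
  one_mem' := fun _ _ => Iff.rfl
  mul_mem' := fun {π σ} hπ hσ a b => (hπ (σ a) (σ b)).trans (hσ a b)
  inv_mem' := fun {π} hπ a b => by
    have h := hπ (π⁻¹ a) (π⁻¹ b)
    simpa using h.symm

/-- The ordered Mostowski model over the linearly ordered set `A` of atoms. -/
abbrev MostowskiModel (A : Type u) [LinearOrder A] : Type (u + 1) :=
  PermModel (orderPermGroup A)

/-! The five sets of the model are described from outside as ranges of explicit families: atoms,
finite sets of atoms, finitely supported sets of atoms, duplicate-free lists and lists. Back and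
forth (`exists_fixes_apply_eq`) shows that the orbits of the pointwise stabilizer of a finite set
`E` are its cut classes: the points of `E` and the open intervals between them. Hence `E` supports a
set of atoms exactly when that set is a union of cut classes (`supports_setObj_iff`).

Equalities are refuted by counting. A bijection in the model with support `E₀` matches the objects
supported by `E` on both sides, for every finite `E ⊇ E₀` (`CardEq.encard_supports_eq`). With `n =
|E|`, there are `n` atoms, `2 ^ n` finite sets, more than `2 ^ n` but at most `2 ^ (2 * n + 1)` sets
of atoms, at least `n!` but finitely many one-to-one sequences, and infinitely many sequences if `E`
is nonempty.

The only inequality needing a construction is `powerset_cardLE_injSeq`. A set `X` of atoms in the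
model has a least support (`CutInvariant.erase`). After ten fixed atoms are added, this support has
enough enumerations to encode which of its cut classes form `X`, because `2 ^ (2 * n + 1) < n!` for
`n ≥ 10`. Since the support is linearly ordered, enumerations correspond to permutations of indices,
and the coding commutes with the group elements fixing the ten atoms. -/

/-! ### Sets, atoms and natural numbers in the universe over `A` -/

namespace ZFA

variable {A : Type u}

/-- The atom `a` as an object of the universe. -/
def atom (a : A) : ZFA A := Quotient.mk (ZFAPre.setoid A) (ZFAPre.atom a)

/-- The set of all values of a small family. -/
noncomputable def range {ι : Type u} (f : ι → ZFA A) : ZFA A :=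
  Quotient.mk (ZFAPre.setoid A) (ZFAPre.mk ι fun i => (f i).out)

theorem mem_range {ι : Type u} {f : ι → ZFA A} {x : ZFA A} : x ∈ range f ↔ ∃ i, x = f i := by
  induction x using Quotient.inductionOn with
  | h y =>
    change (∃ i, ZFAPre.Ext y (f i).out) ↔ _
    refine exists_congr fun i => ?_
    exact ⟨fun h => (Quotient.sound h).trans (Quotient.out_eq _),
      fun h => Quotient.exact (h.trans (Quotient.out_eq _).symm)⟩

theorem not_isAtom_range {ι : Type u} (f : ι → ZFA A) : ¬ IsAtom (range f) := fun h => h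

theorem isAtom_iff {x : ZFA A} : x.IsAtom ↔ ∃ a, x = atom a := by
  induction x using Quotient.inductionOn with
  | h y =>
    cases y with
    | atom a => exact ⟨fun _ => ⟨a, rfl⟩, fun _ => trivial⟩
    | mk ι f => exact ⟨fun h => h.elim, fun ⟨a, h⟩ => (Quotient.exact h : ZFAPre.Ext _ _).elim⟩

theorem atom_injective : Function.Injective (atom : A → ZFA A) := fun _ _ h => Quotient.exact h

theorem not_mem_atom (x : ZFA A) (a : A) : x ∉ atom a := by
  induction x using Quotient.inductionOn with
  | h y => exact fun h => h

theorem ext {x y : ZFA A} (hx : ¬ x.IsAtom) (hy : ¬ y.IsAtom) (h : ∀ z, z ∈ x ↔ z ∈ y) :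
    x = y := by
  induction x using Quotient.inductionOn with
  | h x =>
  induction y using Quotient.inductionOn with
  | h y =>
    cases x with
    | atom a => exact (hx trivial).elim
    | mk ι f =>
      cases y with
      | atom a => exact (hy trivial).elim
      | mk κ g =>
        refine Quotient.sound ⟨fun i => ?_, fun j => ?_⟩
        · exact (h (Quotient.mk _ (f i))).1 ⟨i, ZFAPre.Ext.refl _⟩
        · obtain ⟨i, hi⟩ := (h (Quotient.mk _ (g j))).2 ⟨j, ZFAPre.Ext.refl _⟩
          exact ⟨i, hi.symm⟩

theorem smul_atom (π : Equiv.Perm A) (a : A) : π • atom a = atom (π a) := rfl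

theorem smul_mem_smul (π : Equiv.Perm A) {x y : ZFA A} (h : y ∈ x) : π • y ∈ π • x := by
  induction x using Quotient.inductionOn with
  | h x =>
  induction y using Quotient.inductionOn with
  | h y =>
    cases x with
    | atom a => exact h.elim
    | mk ι f =>
      obtain ⟨i, hi⟩ := h
      exact ⟨i, ZFAPre.act_congr π hi⟩

theorem smul_mem_smul_iff (π : Equiv.Perm A) {x y : ZFA A} : π • y ∈ π • x ↔ y ∈ x :=
  ⟨fun h => by simpa using smul_mem_smul π⁻¹ h, smul_mem_smul π⟩

theorem isAtom_smul_iff (π : Equiv.Perm A) {x : ZFA A} : (π • x).IsAtom ↔ x.IsAtom := by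
  simp only [isAtom_iff]
  constructor
  · rintro ⟨a, h⟩
    exact ⟨π⁻¹ a, by rw [← smul_atom, ← h, inv_smul_smul]⟩
  · rintro ⟨a, rfl⟩
    exact ⟨π a, rfl⟩

/-- Structural induction on codes: a member of a coded family is extensionally equal to one of its
components. -/
theorem mem_wellFounded : WellFounded fun x y : ZFA A => x ∈ y := by
  refine ⟨fun x => ?_⟩
  induction x using Quotient.inductionOn with
  | h x =>
    induction x with
    | atom a => exact ⟨_, fun y h => (not_mem_atom y a h).elim⟩
    | mk ι f ih =>
      refine ⟨_, fun y => ?_⟩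
      induction y using Quotient.inductionOn with
      | h y =>
        rintro ⟨i, hi⟩
        rw [show (Quotient.mk _ y : ZFA A) = Quotient.mk _ (f i) from Quotient.sound hi]
        exact ih i

theorem mem_irrefl (x : ZFA A) : x ∉ x := mem_wellFounded.irrefl.irrefl x

/-- The von Neumann natural numbers. -/
noncomputable def nat (n : ℕ) : ZFA A := range fun i : ULift.{u} (Fin n) => nat i.down
termination_by n
decreasing_by exact i.down.isLt

theorem mem_nat {n : ℕ} {x : ZFA A} : x ∈ nat n ↔ ∃ i < n, x = nat i := by
  rw [nat, mem_range]
  exact ⟨fun ⟨i, h⟩ => ⟨i.down, i.down.isLt, h⟩, fun ⟨i, hi, h⟩ => ⟨⟨⟨i, hi⟩⟩, h⟩⟩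

theorem not_isAtom_nat (n : ℕ) : ¬ (nat n : ZFA A).IsAtom := by
  rw [nat]
  exact not_isAtom_range _

theorem smul_nat (π : Equiv.Perm A) (n : ℕ) : π • (nat n : ZFA A) = nat n := by
  induction n using Nat.strong_induction_on with
  | h n ih =>
    refine ext (mt (isAtom_smul_iff π).1 (not_isAtom_nat n)) (not_isAtom_nat n) fun z => ?_
    rw [← smul_mem_smul_iff π⁻¹, inv_smul_smul, mem_nat, mem_nat]
    refine exists_congr fun i => and_congr_right fun hi => ?_
    rw [inv_smul_eq_iff, ih i hi]

end ZFA

/-! ### Supports and hereditary symmetry -/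

/-- The finite set `E` of points is a support of `x`. -/
def Supports {A : Type*} {G : Subgroup (Equiv.Perm A)} {α : Type*} [MulAction G α] (E : Finset A)
    (x : α) : Prop :=
  ∀ g : G, (∀ a ∈ E, (g : Equiv.Perm A) a = a) → g • x = x

/-- Conjugation: if `k` fixes the image of `E` under `g` pointwise, then `g⁻¹ * k * g` fixes `E`
pointwise. -/
theorem Supports.smul {A : Type*} [DecidableEq A] {G : Subgroup (Equiv.Perm A)} {α : Type*}
    [MulAction G α] {E : Finset A} {x : α} (h : Supports (G := G) E x) (g : G) :
    Supports (G := G) (E.image (g : Equiv.Perm A)) (g • x) := by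
  intro k hk
  have := h (g⁻¹ * k * g) fun a ha => by
    have := hk _ (Finset.mem_image_of_mem _ ha)
    simp [this]
  rwa [mul_smul, mul_smul, inv_smul_eq_iff] at this

theorem inv_fixes {A : Type*} {G : Subgroup (Equiv.Perm A)} {E : Finset A} {g : G}
    (hg : ∀ a ∈ E, (g : Equiv.Perm A) a = a) : ∀ a ∈ E, ((g⁻¹ : G) : Equiv.Perm A) a = a :=
  fun a ha => by
    rw [Subgroup.coe_inv, Equiv.Perm.inv_eq_iff_eq]
    exact (hg a ha).symm

namespace ZFA

variable {A : Type u} {G : Subgroup (Equiv.Perm A)}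

theorem isSymmetric_iff {x : ZFA A} :
    IsSymmetric G x ↔ ∃ E : Finset A, Supports (G := G) E x := by
  constructor
  · rintro ⟨E, hE, h⟩
    exact ⟨hE.toFinset, fun g hg => h ((mem_fixingSubgroup_iff G).2 fun a ha =>
      hg a (hE.mem_toFinset.2 ha))⟩
  · rintro ⟨E, h⟩
    exact ⟨E, E.finite_toSet, fun g hg => h g fun a ha => (mem_fixingSubgroup_iff G).1 hg a ha⟩

theorem HereditarilySymmetric.symmetric {x : ZFA A} (h : HereditarilySymmetric G x) :
    IsSymmetric G x := by
  cases h; assumption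

theorem HereditarilySymmetric.of_mem {x y : ZFA A} (h : HereditarilySymmetric G x) (hy : y ∈ x) :
    HereditarilySymmetric G y := by
  cases h with
  | intro _ _ h => exact h y hy

theorem HereditarilySymmetric.smul {x : ZFA A} (h : HereditarilySymmetric G x) (g : G) :
    HereditarilySymmetric G (g • x) := by
  classical
  induction h with
  | intro x hx _ ih =>
    obtain ⟨E, hE⟩ := isSymmetric_iff.1 hx
    refine ⟨_, isSymmetric_iff.2 ⟨_, hE.smul g⟩, fun y hy => ?_⟩
    have : (g : Equiv.Perm A)⁻¹ • y ∈ x := by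
      rw [← smul_mem_smul_iff (g : Equiv.Perm A), smul_inv_smul]
      exact hy
    have := ih _ this
    rwa [← Subgroup.coe_inv, ← Subgroup.smul_def, smul_inv_smul] at this

theorem hereditarilySymmetric_atom (a : A) : HereditarilySymmetric G (atom a) :=
  ⟨_, isSymmetric_iff.2 ⟨{a}, fun _ hg => congrArg atom (hg a (Finset.mem_singleton_self a))⟩,
    fun y hy => (not_mem_atom y a hy).elim⟩

theorem hereditarilySymmetric_nat (n : ℕ) : HereditarilySymmetric G (nat n) := by
  induction n using Nat.strong_induction_on with
  | h n ih =>
    refine ⟨_, isSymmetric_iff.2 ⟨∅, fun g _ => smul_nat g.1 n⟩, fun y hy => ?_⟩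
    obtain ⟨i, hi, rfl⟩ := mem_nat.1 hy
    exact ih i hi

end ZFA

/-! ### Pairs, natural numbers and symmetric families inside a permutation model -/

namespace PermModel

variable {A : Type u} {G : Subgroup (Equiv.Perm A)}

instance : MulAction G (PermModel G) where
  smul g x := ⟨g • x.1, x.2.smul g⟩
  one_smul x := Subtype.ext (one_smul G x.1)
  mul_smul g h x := Subtype.ext (mul_smul g h x.1)

theorem exists_supports (x : PermModel G) : ∃ E : Finset A, Supports (G := G) E x := by
  obtain ⟨E, hE⟩ := ZFA.isSymmetric_iff.1 x.2.symmetric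
  exact ⟨E, fun g hg => Subtype.ext (hE g hg)⟩

theorem smul_mem_smul_iff (g : G) {x y : PermModel G} : g • y ∈ g • x ↔ y ∈ x :=
  ZFA.smul_mem_smul_iff g.1

theorem isSet_smul_iff (g : G) {x : PermModel G} : (g • x).IsSet ↔ x.IsSet :=
  not_congr (ZFA.isAtom_smul_iff g.1)

theorem mem_smul_iff (g : G) {x y : PermModel G} : y ∈ g • x ↔ g⁻¹ • y ∈ x := by
  rw [← smul_mem_smul_iff g⁻¹, inv_smul_smul]

/-- The model is a transitive class, so extensionality is inherited from the universe. -/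
theorem ext {x y : PermModel G} (hx : x.IsSet) (hy : y.IsSet) (h : ∀ z, z ∈ x ↔ z ∈ y) :
    x = y :=
  Subtype.ext <| ZFA.ext hx hy fun z =>
    ⟨fun hz => (h ⟨z, x.2.of_mem hz⟩).1 hz, fun hz => (h ⟨z, y.2.of_mem hz⟩).2 hz⟩

theorem mem_wellFounded : WellFounded fun x y : PermModel G => x ∈ y :=
  InvImage.wf Subtype.val ZFA.mem_wellFounded

theorem mem_irrefl (x : PermModel G) : x ∉ x := ZFA.mem_irrefl x.1

/-- The family `f` of objects is invariant under all group elements fixing a certain finite set. -/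
def IsSymmFamily {ι : Type*} (f : ι → PermModel G) : Prop :=
  ∃ E : Finset A, ∀ g : G, (∀ a ∈ E, (g : Equiv.Perm A) a = a) → ∀ i, ∃ j, g • f i = f j

/-- The set of all values of a symmetric small family. -/
noncomputable def range {ι : Type u} (f : ι → PermModel G) (hf : IsSymmFamily f) : PermModel G :=
  ⟨ZFA.range fun i => (f i).1, by
    obtain ⟨E, hE⟩ := hf
    -- One inclusion suffices: applied to both `g` and `g⁻¹` it gives invariance.
    have key : ∀ g : G, (∀ a ∈ E, (g : Equiv.Perm A) a = a) → ∀ z,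
        z ∈ ZFA.range (fun i => (f i).1) → g.1 • z ∈ ZFA.range (fun i => (f i).1) := by
      intro g hg z hz
      obtain ⟨i, rfl⟩ := ZFA.mem_range.1 hz
      obtain ⟨j, hj⟩ := hE g hg i
      exact ZFA.mem_range.2 ⟨j, congrArg Subtype.val hj⟩
    refine ⟨_, ZFA.isSymmetric_iff.2 ⟨E, fun g hg => ?_⟩, fun y hy => ?_⟩
    · refine ZFA.ext (mt (ZFA.isAtom_smul_iff g.1).1 (ZFA.not_isAtom_range _))
        (ZFA.not_isAtom_range _) fun z => ⟨fun hz => ?_, fun hz => ?_⟩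
      · have : g.1⁻¹ • z ∈ ZFA.range (fun i => (f i).1) := by
          rw [← ZFA.smul_mem_smul_iff g.1, smul_inv_smul]
          exact hz
        simpa using key g hg _ this
      · have := (ZFA.smul_mem_smul_iff g.1).2 (key g⁻¹ (inv_fixes hg) z hz)
        rwa [Subgroup.coe_inv, smul_inv_smul] at this
    · obtain ⟨i, rfl⟩ := ZFA.mem_range.1 hy
      exact (f i).2⟩

theorem mem_range {ι : Type u} {f : ι → PermModel G} {hf : IsSymmFamily f} {x : PermModel G} :
    x ∈ range f hf ↔ ∃ i, x = f i :=
  ZFA.mem_range.trans (exists_congr fun _ => Subtype.ext_iff.symm)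

theorem isSet_range {ι : Type u} (f : ι → PermModel G) (hf : IsSymmFamily f) :
    IsSet (range f hf) := ZFA.not_isAtom_range _

theorem eq_range_iff {ι : Type u} {f : ι → PermModel G} {hf : IsSymmFamily f} {x : PermModel G} :
    x = range f hf ↔ IsSet x ∧ ∀ z, z ∈ x ↔ ∃ i, z = f i := by
  constructor
  · rintro rfl
    exact ⟨isSet_range _ _, fun z => mem_range⟩
  · rintro ⟨hx, h⟩
    exact ext hx (isSet_range _ _) fun z => (h z).trans mem_range.symm

/-- The union of supports of the finitely many values fixes each value separately. -/
theorem IsSymmFamily.of_finite {ι : Type*} [Finite ι] (f : ι → PermModel G) : IsSymmFamily f := by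
  classical
  cases nonempty_fintype ι
  choose E hE using fun i => exists_supports (f i)
  exact ⟨Finset.univ.biUnion E, fun g hg i => ⟨i, hE i g fun a ha =>
    hg a (Finset.mem_biUnion.2 ⟨i, Finset.mem_univ i, ha⟩)⟩⟩

/-- The unordered pair. -/
noncomputable def upair (x y : PermModel G) : PermModel G :=
  range (fun b : ULift.{u} Bool => cond b.down x y) (.of_finite _)

theorem mem_upair {x y z : PermModel G} : z ∈ upair x y ↔ z = x ∨ z = y := by
  rw [upair, mem_range]
  constructor
  · rintro ⟨⟨_ | _⟩, h⟩
    exacts [Or.inr h, Or.inl h]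
  · rintro (h | h)
    exacts [⟨⟨true⟩, h⟩, ⟨⟨false⟩, h⟩]

theorem isUPair_iff {x y z : PermModel G} : IsUPair z x y ↔ z = upair x y := by
  constructor
  · rintro ⟨h, h'⟩
    exact ext h (isSet_range _ _) fun w => (h' w).trans mem_upair.symm
  · rintro rfl
    exact ⟨isSet_range _ _, fun w => mem_upair⟩

theorem upair_eq_upair_iff {x y x' y' : PermModel G} :
    upair x y = upair x' y' ↔ x = x' ∧ y = y' ∨ x = y' ∧ y = x' := by
  rw [← Set.pair_eq_pair_iff]
  constructor
  · intro h
    ext z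
    simpa [mem_upair] using (iff_of_eq (congrArg (z ∈ ·) h))
  · intro h
    refine ext (isSet_range _ _) (isSet_range _ _) fun z => ?_
    simpa [mem_upair] using (iff_of_eq (congrArg (z ∈ ·) h))

theorem smul_upair (g : G) (x y : PermModel G) : g • upair x y = upair (g • x) (g • y) :=
  ext ((isSet_smul_iff g).2 (isSet_range _ _)) (isSet_range _ _) fun z => by
    rw [mem_smul_iff, mem_upair, mem_upair, inv_smul_eq_iff, inv_smul_eq_iff]

/-- The ordered pair. -/
noncomputable def opair (x y : PermModel G) : PermModel G := upair (upair x x) (upair x y)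

theorem isOPair_iff {x y z : PermModel G} : IsOPair z x y ↔ z = opair x y := by
  rw [opair, ← isUPair_iff, IsUPair]
  simp only [IsOPair, isUPair_iff]

theorem opair_inj {x y x' y' : PermModel G} : opair x y = opair x' y' ↔ x = x' ∧ y = y' := by
  simp only [opair, upair_eq_upair_iff]
  grind

theorem smul_opair (g : G) (x y : PermModel G) : g • opair x y = opair (g • x) (g • y) := by
  simp only [opair, smul_upair]

/-- The atom `a` as an object of the model. -/
def atom (a : A) : PermModel G := ⟨ZFA.atom a, ZFA.hereditarilySymmetric_atom a⟩

theorem isAtom_iff {x : PermModel G} : x.IsAtom ↔ ∃ a, x = atom a :=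
  ZFA.isAtom_iff.trans (exists_congr fun a => (Subtype.ext_iff (a2 := atom a)).symm)

theorem atom_injective : Function.Injective (atom : A → PermModel G) := fun _ _ h =>
  ZFA.atom_injective (congrArg Subtype.val h)

theorem smul_atom (g : G) (a : A) : g • (atom a : PermModel G) = atom ((g : Equiv.Perm A) a) := rfl

/-- The von Neumann natural numbers of the model. -/
noncomputable def nat (n : ℕ) : PermModel G := ⟨ZFA.nat n, ZFA.hereditarilySymmetric_nat n⟩

theorem mem_nat {n : ℕ} {x : PermModel G} : x ∈ nat n ↔ ∃ i < n, x = nat i :=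
  ZFA.mem_nat.trans (exists_congr fun _ => and_congr_right fun _ =>
    (Subtype.ext_iff (a2 := nat _)).symm)

theorem isSet_nat (n : ℕ) : IsSet (nat n : PermModel G) := ZFA.not_isAtom_nat n

theorem smul_nat (g : G) (n : ℕ) : g • (nat n : PermModel G) = nat n :=
  Subtype.ext (ZFA.smul_nat g.1 n)

theorem nat_injective : Function.Injective (nat : ℕ → PermModel G) := by
  have : ∀ m n : ℕ, m < n → (nat m : PermModel G) ≠ nat n := fun m n h e =>
    mem_irrefl (nat n : PermModel G) (by
      exact mem_nat.2 ⟨m, h, e.symm⟩)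
  intro m n h
  rcases lt_trichotomy m n with hl | hl | hl
  exacts [(this m n hl h).elim, hl, (this n m hl h.symm).elim]

theorem nat_mem_nat {m n : ℕ} : (nat m : PermModel G) ∈ (nat n : PermModel G) ↔ m < n := by
  rw [mem_nat]
  exact ⟨fun ⟨i, hi, h⟩ => nat_injective h ▸ hi, fun h => ⟨m, h, rfl⟩⟩

theorem isOrdinal_nat (n : ℕ) : IsOrdinal (nat n : PermModel G) := by
  refine ⟨isSet_nat n, ?_, fun x _ => mem_irrefl x, ?_, ?_, ?_⟩
  · intro x hx
    obtain ⟨i, hi, rfl⟩ := mem_nat.1 hx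
    refine ⟨isSet_nat i, fun z hz => ?_⟩
    obtain ⟨j, hj, rfl⟩ := mem_nat.1 hz
    exact nat_mem_nat.2 (hj.trans hi)
  · intro x y z hx hy hz
    obtain ⟨i, -, rfl⟩ := mem_nat.1 hx
    obtain ⟨j, -, rfl⟩ := mem_nat.1 hy
    obtain ⟨k, -, rfl⟩ := mem_nat.1 hz
    simp only [nat_mem_nat]
    exact lt_trans
  · intro x y hx hy
    obtain ⟨i, -, rfl⟩ := mem_nat.1 hx
    obtain ⟨j, -, rfl⟩ := mem_nat.1 hy
    simp only [nat_mem_nat, nat_injective.eq_iff]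
    exact lt_trichotomy i j
  · rintro s ⟨-, hs⟩ ⟨x, hx⟩
    classical
    obtain ⟨i, -, rfl⟩ := mem_nat.1 (hs x hx)
    have hex : ∃ i, (nat i : PermModel G) ∈ s := ⟨i, hx⟩
    refine ⟨_, Nat.find_spec hex, fun y hy => ?_⟩
    obtain ⟨j, -, rfl⟩ := mem_nat.1 (hs y hy)
    rw [nat_mem_nat, nat_injective.eq_iff]
    exact (Nat.find_min' hex hy).eq_or_lt

theorem isSucc_nat_iff {x : PermModel G} {n : ℕ} : IsSucc x (nat n) ↔ x = nat (n + 1) := by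
  have : ∀ z : PermModel G, z ∈ (nat (n + 1) : PermModel G) ↔ z ∈ (nat n : PermModel G) ∨ z = nat n := by
    intro z
    simp only [mem_nat, Order.lt_add_one_iff, le_iff_lt_or_eq]
    grind
  constructor
  · rintro ⟨hx, h⟩
    exact ext hx (isSet_nat _) fun z => (h z).trans (this z).symm
  · rintro rfl
    exact ⟨isSet_nat _, this⟩

theorem eq_nat_zero {x : PermModel G} (hx : x.IsSet) (h : ∀ z, z ∉ x) : x = nat 0 :=
  ext hx (isSet_nat 0) fun z => by simp [mem_nat, h z]

/-- The notion is absolute: by ∈-induction, `x` and each of its elements is empty or the successor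
of a standard number. So finiteness in the model is compared with actual finiteness, and sequences
become lists. -/
theorem isNat_iff {x : PermModel G} : IsNat x ↔ ∃ n : ℕ, x = nat n := by
  constructor
  · rintro ⟨hx, h⟩
    have key : ∀ k, k = x ∨ k ∈ x → ∃ n : ℕ, k = nat n := by
      intro k
      induction k using mem_wellFounded.induction with
      | h k ih =>
        intro hk
        have hsub : IsSubset k x := by
          rcases hk with rfl | hk
          exacts [⟨hx.1, fun z hz => hz⟩, hx.2.1 k hk]
        rcases h k hk with h0 | ⟨j, -, hj⟩
        · exact ⟨0, eq_nat_zero hsub.1 h0⟩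
        · have hjk : j ∈ k := (hj.2 j).2 (Or.inr rfl)
          obtain ⟨n, rfl⟩ := ih j hjk (Or.inr (hsub.2 j hjk))
          exact ⟨n + 1, isSucc_nat_iff.1 hj⟩
    exact key x (Or.inl rfl)
  · rintro ⟨n, rfl⟩
    refine ⟨isOrdinal_nat n, fun k hk => ?_⟩
    obtain ⟨m, rfl⟩ : ∃ m, k = nat m := by
      rcases hk with rfl | hk
      · exact ⟨n, rfl⟩
      · obtain ⟨i, -, rfl⟩ := mem_nat.1 hk
        exact ⟨i, rfl⟩
    cases m with
    | zero => exact Or.inl fun z hz => by simp [mem_nat] at hz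
    | succ m => exact Or.inr ⟨nat m, isOrdinal_nat m, isSucc_nat_iff.2 rfl⟩

/-! ### Functions given by families of pairs -/

/-- The relation consisting of all pairs `⟨u i, v i⟩`. -/
noncomputable def graph {ι : Type u} (u v : ι → PermModel G)
    (h : IsSymmFamily fun i => opair (u i) (v i)) : PermModel G :=
  range (fun i => opair (u i) (v i)) h

theorem opair_mem_graph {ι : Type u} {u v : ι → PermModel G}
    {h : IsSymmFamily fun i => opair (u i) (v i)} {x y : PermModel G} :
    opair x y ∈ graph u v h ↔ ∃ i, x = u i ∧ y = v i := by
  simp only [graph, mem_range, opair_inj]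

theorem isFunction_iff {f x y : PermModel G} :
    IsFunction f x y ↔ IsSet f ∧ (∀ p, p ∈ f → ∃ u v, u ∈ x ∧ v ∈ y ∧ p = opair u v) ∧
      ∀ u, u ∈ x → ∃! v, opair u v ∈ f := by
  simp only [IsFunction, isOPair_iff, exists_eq_right]

theorem isInjection_iff {f x y : PermModel G} :
    IsInjection f x y ↔ IsFunction f x y ∧
      ∀ u u' v, opair u v ∈ f → opair u' v ∈ f → u = u' := by
  simp only [IsInjection, isOPair_iff]
  refine and_congr_right fun _ => ⟨fun h u u' v h1 h2 => h u u' v _ _ h1 h2 rfl rfl, ?_⟩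
  rintro h u u' v p p' h1 h2 rfl rfl
  exact h u u' v h1 h2

theorem isBijection_iff {f x y : PermModel G} :
    IsBijection f x y ↔ IsInjection f x y ∧ ∀ v, v ∈ y → ∃ u, opair u v ∈ f := by
  simp only [IsBijection, isOPair_iff, exists_eq_right]

theorem isFunction_graph_iff {ι : Type u} {u v : ι → PermModel G}
    {h : IsSymmFamily fun i => opair (u i) (v i)} (hu : Function.Injective u) {x y : PermModel G}
    (hx : ∀ z, z ∈ x ↔ ∃ i, z = u i) : IsFunction (graph u v h) x y ↔ ∀ i, v i ∈ y := by
  rw [isFunction_iff]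
  constructor
  · rintro ⟨-, h2, -⟩ i
    obtain ⟨a, b, -, hb, e⟩ := h2 _ (mem_range.2 ⟨i, rfl⟩)
    exact (opair_inj.1 e).2 ▸ hb
  · refine fun hv => ⟨isSet_range _ _, fun p hp => ?_, fun a ha => ?_⟩
    · obtain ⟨i, rfl⟩ := mem_range.1 hp
      exact ⟨u i, v i, (hx _).2 ⟨i, rfl⟩, hv i, rfl⟩
    · obtain ⟨i, rfl⟩ := (hx a).1 ha
      refine ⟨v i, opair_mem_graph.2 ⟨i, rfl, rfl⟩, fun b hb => ?_⟩
      obtain ⟨j, hj, rfl⟩ := opair_mem_graph.1 hb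
      rw [hu hj]

theorem isInjection_graph_iff {ι : Type u} {u v : ι → PermModel G}
    {h : IsSymmFamily fun i => opair (u i) (v i)} (hu : Function.Injective u) {x y : PermModel G}
    (hx : ∀ z, z ∈ x ↔ ∃ i, z = u i) :
    IsInjection (graph u v h) x y ↔ (∀ i, v i ∈ y) ∧ Function.Injective v := by
  rw [isInjection_iff, isFunction_graph_iff hu hx]
  refine and_congr_right fun _ => ⟨fun h i j e => ?_, fun hv a a' b => ?_⟩
  · exact hu (h _ _ (v i) (opair_mem_graph.2 ⟨i, rfl, rfl⟩) (opair_mem_graph.2 ⟨j, rfl, e⟩))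
  · simp only [opair_mem_graph]
    rintro ⟨i, rfl, rfl⟩ ⟨j, rfl, e⟩
    rw [hv e]

/-- An external injection lies in the model once its graph has a support; this is the source of all
four inequalities `≤`. -/
theorem cardLE_of_family {ι : Type u} {u v : ι → PermModel G} {x y : PermModel G}
    (hu : Function.Injective u) (hv : Function.Injective v) (hx : ∀ z, z ∈ x ↔ ∃ i, z = u i)
    (hy : ∀ i, v i ∈ y) (E : Finset A)
    (h : ∀ g : G, (∀ a ∈ E, (g : Equiv.Perm A) a = a) →
      ∀ i, ∃ j, g • u i = u j ∧ g • v i = v j) : CardLE x y := by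
  refine ⟨graph u v ⟨E, fun g hg i => ?_⟩, (isInjection_graph_iff hu hx).2 ⟨hy, hv⟩⟩
  obtain ⟨j, h1, h2⟩ := h g hg i
  exact ⟨j, by rw [smul_opair, h1, h2]⟩

/-- A bijection in the model restricts to a bijection between the elements which are supported by
any finite set extending a support of it. -/
theorem CardEq.encard_supports_eq {x y : PermModel G} (h : CardEq x y) :
    ∃ E₀ : Finset A, ∀ E : Finset A, E₀ ⊆ E →
      {u | u ∈ x ∧ Supports (G := G) E u}.encard = {v | v ∈ y ∧ Supports (G := G) E v}.encard := by
  obtain ⟨f, hf⟩ := h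
  obtain ⟨⟨hfun, hinj⟩, hsurj⟩ := (isBijection_iff.1 hf).imp_left isInjection_iff.1
  obtain ⟨-, hdom, hval⟩ := isFunction_iff.1 hfun
  obtain ⟨E₀, hE₀⟩ := exists_supports f
  refine ⟨E₀, fun E hE => ?_⟩
  have hmem : ∀ u v, opair u v ∈ f → u ∈ x ∧ v ∈ y := by
    intro u v h
    obtain ⟨u', v', hu, hv, e⟩ := hdom _ h
    obtain ⟨rfl, rfl⟩ := opair_inj.1 e
    exact ⟨hu, hv⟩
  have hfix : ∀ g : G, (∀ a ∈ E, (g : Equiv.Perm A) a = a) → ∀ u v, opair u v ∈ f →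
      opair (g • u) (g • v) ∈ f := by
    intro g hg u v h
    rw [← smul_opair, ← hE₀ g fun a ha => hg a (hE ha)]
    exact (smul_mem_smul_iff g).2 h
  have : Nonempty (PermModel G) := ⟨x⟩
  choose! F hF hF' using hval
  suffices h : Set.BijOn F {u | u ∈ x ∧ Supports (G := G) E u}
      {v | v ∈ y ∧ Supports (G := G) E v} by
    rw [← h.image_eq, h.injOn.encard_image]
  refine ⟨?_, ?_, ?_⟩
  · rintro u ⟨hu, hs⟩
    refine ⟨(hmem _ _ (hF u hu)).2, fun g hg => ?_⟩
    -- Since `g` fixes `u`, both `F u` and `g • F u` are values at `u`, and values are unique.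
    have := hfix g hg _ _ (hF u hu)
    rw [hs g hg] at this
    exact hF' u hu _ this
  · rintro u ⟨hu, -⟩ u' ⟨hu', -⟩ e
    exact hinj u u' (F u) (hF u hu) (e ▸ hF u' hu')
  · rintro v ⟨hv, hs⟩
    obtain ⟨u, huv⟩ := hsurj v hv
    have hu := (hmem _ _ huv).1
    refine ⟨u, ⟨hu, fun g hg => ?_⟩, (hF' u hu v huv).symm⟩
    have := hfix g hg _ _ huv
    rw [hs g hg] at this
    exact hinj _ _ _ this huv

end PermModel

/-! ### Back and forth -/

/-- A finite partial isomorphism of countable dense linear orders without endpoints extends to an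
isomorphism. -/
theorem Order.exists_orderIso_of_partialIso {α β : Type*} [LinearOrder α] [LinearOrder β]
    [Countable α] [DenselyOrdered α] [NoMinOrder α] [NoMaxOrder α] [Nonempty α] [Countable β]
    [DenselyOrdered β] [NoMinOrder β] [NoMaxOrder β] [Nonempty β] (f₀ : Order.PartialIso α β) :
    ∃ e : α ≃o β, ∀ p ∈ f₀.1, e p.1 = p.2 := by
  cases nonempty_encodable α
  cases nonempty_encodable β
  let to_cofinal : α ⊕ β → Order.Cofinal (Order.PartialIso α β) := fun p ↦
    Sum.recOn p (Order.PartialIso.definedAtLeft β) (Order.PartialIso.definedAtRight α)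
  let I : Order.Ideal (Order.PartialIso α β) := Order.idealOfCofinals f₀ to_cofinal
  let F a := Order.PartialIso.funOfIdeal a I
    (Order.cofinal_meets_idealOfCofinals _ to_cofinal (Sum.inl a))
  let G b := Order.PartialIso.invOfIdeal b I
    (Order.cofinal_meets_idealOfCofinals _ to_cofinal (Sum.inr b))
  refine ⟨OrderIso.ofCmpEqCmp (fun a ↦ (F a).val) (fun b ↦ (G b).val) fun a b ↦ ?_, fun p hp => ?_⟩
  · rcases (F a).prop with ⟨f, hf, ha⟩
    rcases (G b).prop with ⟨g, hg, hb⟩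
    rcases I.directed _ hf _ hg with ⟨m, _, fm, gm⟩
    exact m.prop (a, _) (fm ha) (_, b) (gm hb)
  · change (F p.1).val = p.2
    rcases (F p.1).prop with ⟨f, hf, ha⟩
    -- `f₀` itself lies in the ideal, so it has a common extension with the approximation defining
    -- the value at `p.1`.
    rcases I.directed _ hf _ (Order.mem_idealOfCofinals f₀ to_cofinal) with ⟨m, _, fm, gm⟩
    have := m.prop (p.1, _) (fm ha) p (gm hp)
    rw [cmp_self_eq_eq] at this
    exact (cmp_eq_eq_iff _ _).1 this.symm

/-! ### Cut classes as orbits -/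

section

variable {A : Type u} [LinearOrder A]

theorem strictMono_of_orderPermGroup (g : orderPermGroup A) : StrictMono (g : Equiv.Perm A) :=
  fun a b h => (g.2 a b).2 h

/-- The points `a` and `b` define the same cut in `E`. -/
def SameCut (E : Finset A) (a b : A) : Prop := ∀ e ∈ E, (e < a ↔ e < b) ∧ (e ≤ a ↔ e ≤ b)

theorem SameCut.symm {E : Finset A} {a b : A} (h : SameCut E a b) : SameCut E b a :=
  fun e he => ⟨(h e he).1.symm, (h e he).2.symm⟩

theorem SameCut.mono {E E' : Finset A} {a b : A} (h : SameCut E' a b) (hE : E ⊆ E') :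
    SameCut E a b := fun e he => h e (hE he)

theorem SameCut.eq_of_mem {E : Finset A} {a b : A} (h : SameCut E a b) (ha : a ∈ E) : a = b := by
  have := h a ha
  grind

theorem sameCut_of_fixes {E : Finset A} {g : orderPermGroup A}
    (hg : ∀ a ∈ E, (g : Equiv.Perm A) a = a) (a : A) : SameCut E a ((g : Equiv.Perm A) a) := by
  intro e he
  have h := strictMono_of_orderPermGroup g
  rw [← h.lt_iff_lt (a := e), ← h.le_iff_le (a := e), hg e he]
  exact ⟨Iff.rfl, Iff.rfl⟩

/-- Homogeneity: the identity on `E` together with `a ↦ b` is a finite partial isomorphism, and back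
and forth extends it. -/
theorem exists_fixes_apply_eq [Countable A] [DenselyOrdered A] [NoMinOrder A] [NoMaxOrder A]
    {E : Finset A} {a b : A} (h : SameCut E a b) :
    ∃ g : orderPermGroup A, (∀ e ∈ E, (g : Equiv.Perm A) e = e) ∧ (g : Equiv.Perm A) a = b := by
  have : Nonempty A := ⟨a⟩
  have hcmp : ∀ e ∈ E, cmp e a = cmp e b := by
    intro e he
    have := h e he
    rcases lt_trichotomy e a with h | h | h
    · rw [h.cmp_eq_lt, (this.1.1 h).cmp_eq_lt]
    · have : e = b := by grind
      simp [h, ← this]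
    · rw [h.cmp_eq_gt, LT.lt.cmp_eq_gt (by grind)]
  obtain ⟨e, he⟩ := Order.exists_orderIso_of_partialIso
    (⟨insert (a, b) (E.image fun e => (e, e)), by
      intro p hp q hq
      simp only [Finset.mem_insert, Finset.mem_image] at hp hq
      rcases hp with rfl | ⟨x, hx, rfl⟩ <;> rcases hq with rfl | ⟨y, hy, rfl⟩
      · simp
      · rw [cmp_eq_cmp_symm]
        exact hcmp y hy
      · exact hcmp x hx
      · rfl⟩ : Order.PartialIso A A)
  exact ⟨⟨e.toEquiv, fun x y => e.lt_iff_lt⟩,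
    fun x hx => he (x, x) (Finset.mem_insert_of_mem (Finset.mem_image_of_mem _ hx)),
    he (a, b) (Finset.mem_insert_self _ _)⟩

/-- Supplies points so close to `c` that nothing in `T` separates them from `c`, other than possibly
`c` itself. -/
theorem exists_lt_forall_lt [DenselyOrdered A] [NoMinOrder A] (T : Finset A) (c : A) :
    ∃ p < c, ∀ t ∈ T, t < c → t < p := by
  induction T using Finset.induction_on with
  | empty => simpa using exists_lt c
  | insert a T _ ih =>
    obtain ⟨p, hp, h⟩ := ih
    by_cases ha : a < c
    · obtain ⟨q, h1, h2⟩ := exists_between (max_lt hp ha)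
      refine ⟨q, h2, fun t ht htc => ?_⟩
      have := max_lt_iff.1 h1
      grind
    · exact ⟨p, hp, by grind⟩

theorem exists_gt_forall_gt [DenselyOrdered A] [NoMaxOrder A] (T : Finset A) (c : A) :
    ∃ p > c, ∀ t ∈ T, c < t → p < t := by
  induction T using Finset.induction_on with
  | empty => simpa using exists_gt c
  | insert a T _ ih =>
    obtain ⟨p, hp, h⟩ := ih
    by_cases ha : c < a
    · obtain ⟨q, h1, h2⟩ := exists_between (lt_min hp ha)
      refine ⟨q, h1, fun t ht htc => ?_⟩
      have := lt_min_iff.1 h2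
      grind
    · exact ⟨p, hp, by grind⟩

theorem exists_ne_sameCut [DenselyOrdered A] [NoMinOrder A] {E : Finset A} {a : A} (ha : a ∉ E) :
    ∃ b, b ≠ a ∧ SameCut E a b := by
  obtain ⟨b, hb, h⟩ := exists_lt_forall_lt E a
  refine ⟨b, hb.ne, fun e he => ?_⟩
  have := h e he
  have : e ≠ a := fun h => ha (h ▸ he)
  grind

/-! ### Unions of cut classes and least supports -/

/-- The set `X` is a union of cut classes of `E`. -/
def CutInvariant (E : Finset A) (X : Set A) : Prop := ∀ a b, SameCut E a b → (a ∈ X ↔ b ∈ X)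

theorem CutInvariant.mono {E E' : Finset A} {X : Set A} (h : CutInvariant E X) (hE : E ⊆ E') :
    CutInvariant E' X := fun a b hab => h a b (hab.mono hE)

/-- A point of `s` outside `E` could be moved slightly to the left, within its cut class, to a point
outside the finite set `s`. -/
theorem cutInvariant_coe_iff [DenselyOrdered A] [NoMinOrder A] {E s : Finset A} :
    CutInvariant E (s : Set A) ↔ s ⊆ E := by
  constructor
  · intro h a ha
    by_contra haE
    obtain ⟨b, hb, h'⟩ := exists_lt_forall_lt (E ∪ s) a
    have hab : SameCut E a b := fun e he => by
      have := h' e (Finset.mem_union_left _ he)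
      have : e ≠ a := fun h => haE (h ▸ he)
      grind
    have := (h a b hab).1 ha
    exact lt_irrefl b (h' b (Finset.mem_union_right _ this) hb)
  · intro h a b hab
    exact ⟨fun ha => hab.eq_of_mem (h ha) ▸ ha, fun hb => hab.symm.eq_of_mem (h hb) ▸ hb⟩

theorem cutInvariant_iff_image_eq [Countable A] [DenselyOrdered A] [NoMinOrder A] [NoMaxOrder A]
    {E : Finset A} {X : Set A} : CutInvariant E X ↔
      ∀ g : orderPermGroup A, (∀ a ∈ E, (g : Equiv.Perm A) a = a) →
        (g : Equiv.Perm A) '' X = X := by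
  constructor
  · intro h g hg
    ext b
    rw [Equiv.image_eq_preimage_symm]
    exact (h b _ (sameCut_of_fixes (inv_fixes hg) b)).symm
  · intro h a b hab
    obtain ⟨g, hg, rfl⟩ := exists_fixes_apply_eq hab
    conv_rhs => rw [← h g hg, (g : Equiv.Perm A).injective.mem_set_image]

theorem sameCut_image_iff (g : orderPermGroup A) {E : Finset A} {a b : A} :
    SameCut (E.image (g : Equiv.Perm A)) ((g : Equiv.Perm A) a) ((g : Equiv.Perm A) b) ↔
      SameCut E a b := by
  have h := strictMono_of_orderPermGroup g
  rw [SameCut, Finset.forall_mem_image]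
  refine forall₂_congr fun e _ => ?_
  rw [h.lt_iff_lt, h.lt_iff_lt, h.le_iff_le, h.le_iff_le]

theorem cutInvariant_image_iff (g : orderPermGroup A) {E : Finset A} {X : Set A} :
    CutInvariant (E.image (g : Equiv.Perm A)) ((g : Equiv.Perm A) '' X) ↔ CutInvariant E X := by
  refine (g : Equiv.Perm A).surjective.forall.trans (forall_congr' fun a =>
    (g : Equiv.Perm A).surjective.forall.trans (forall_congr' fun b => ?_))
  rw [sameCut_image_iff, (g : Equiv.Perm A).injective.mem_set_image,
    (g : Equiv.Perm A).injective.mem_set_image]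

/-- Dropping `c` merges the class `{c}` with its two neighbouring intervals. As `c ∉ E'`, invariance
under `E'` says that `X` does not distinguish `c` from points very close to it, on either side. -/
theorem CutInvariant.erase [DenselyOrdered A] [NoMinOrder A] [NoMaxOrder A] {E E' : Finset A}
    {X : Set A} (h : CutInvariant E X) (h' : CutInvariant E' X) {c : A} (hc : c ∉ E') :
    CutInvariant (E.erase c) X := by
  have left : ∀ a b, SameCut (E.erase c) a b → a < c → c ≤ b → (a ∈ X ↔ c ∈ X) := by
    intro a b hab hac hcb
    obtain ⟨p, hp, hpt⟩ := exists_lt_forall_lt (insert a (E ∪ E')) c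
    have hap := hpt a (Finset.mem_insert_self _ _) hac
    -- The point `p` lies in the `E`-class of `a` and in the `E'`-class of `c`.
    refine (h a p fun e he => ?_).trans (h' p c fun e he => ?_)
    · have := hpt e (by grind)
      by_cases hec : e = c
      · grind
      · have := hab e (by grind)
        grind
    · have := hpt e (by grind)
      have : e ≠ c := fun h => hc (h ▸ he)
      grind
  have right : ∀ a b, SameCut (E.erase c) a b → a ≤ c → c < b → (c ∈ X ↔ b ∈ X) := by
    intro a b hab hac hcb
    obtain ⟨p, hp, hpt⟩ := exists_gt_forall_gt (insert b (E ∪ E')) c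
    have hap := hpt b (Finset.mem_insert_self _ _) hcb
    refine (h' c p fun e he => ?_).trans (h p b fun e he => ?_)
    · have := hpt e (by grind)
      have : e ≠ c := fun h => hc (h ▸ he)
      grind
    · have := hpt e (by grind)
      by_cases hec : e = c
      · grind
      · have := hab e (by grind)
        grind
  have key : ∀ a b, a ≤ b → SameCut (E.erase c) a b → (a ∈ X ↔ b ∈ X) := by
    intro a b hle hab
    by_cases hac : a ≤ c
    · by_cases hcb : c ≤ b
      · have h1 : a ∈ X ↔ c ∈ X := by
          rcases hac.eq_or_lt with rfl | hac
          exacts [Iff.rfl, left a b hab hac hcb]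
        have h2 : c ∈ X ↔ b ∈ X := by
          rcases hcb.eq_or_lt with rfl | hcb
          exacts [Iff.rfl, right a b hab hac hcb]
        exact h1.trans h2
      · refine h a b fun e he => ?_
        by_cases hec : e = c
        · grind
        · exact hab e (by grind)
    · refine h a b fun e he => ?_
      by_cases hec : e = c
      · grind
      · exact hab e (by grind)
  intro a b hab
  rcases le_total a b with hle | hle
  exacts [key a b hle hab, (key b a hle hab.symm).symm]

/-- A support of minimal cardinality is least: a point of it missing from another support could be
erased. -/
theorem exists_least_cutInvariant [DenselyOrdered A] [NoMinOrder A] [NoMaxOrder A] {X : Set A}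
    (hX : ∃ E, CutInvariant E X) :
    ∃ E, CutInvariant E X ∧ ∀ E', CutInvariant E' X → E ⊆ E' := by
  classical
  have hex : ∃ n, ∃ E, CutInvariant E X ∧ E.card = n := by
    obtain ⟨E, hE⟩ := hX
    exact ⟨_, E, hE, rfl⟩
  obtain ⟨E, hE, hcard⟩ := Nat.find_spec hex
  refine ⟨E, hE, fun E' hE' c hc => ?_⟩
  by_contra hcE
  refine Nat.find_min hex ?_ ⟨_, hE.erase hE' hcE, rfl⟩
  rw [← hcard]
  exact Finset.card_erase_lt_of_mem hc

open Classical in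
/-- The least support of `X`. -/
noncomputable def leastSupp [DenselyOrdered A] [NoMinOrder A] [NoMaxOrder A] (X : Set A) :
    Finset A :=
  if h : ∃ E, CutInvariant E X then (exists_least_cutInvariant h).choose else ∅

section

variable [DenselyOrdered A] [NoMinOrder A] [NoMaxOrder A]

theorem cutInvariant_leastSupp {X : Set A} (h : ∃ E, CutInvariant E X) :
    CutInvariant (leastSupp X) X := by
  rw [leastSupp, dif_pos h]
  exact (exists_least_cutInvariant h).choose_spec.1

theorem leastSupp_subset {X : Set A} {E : Finset A} (h : CutInvariant E X) : leastSupp X ⊆ E := by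
  rw [leastSupp, dif_pos ⟨E, h⟩]
  exact (exists_least_cutInvariant ⟨E, h⟩).choose_spec.2 E h

theorem leastSupp_image_subset (g : orderPermGroup A) {X : Set A} (h : ∃ E, CutInvariant E X) :
    leastSupp ((g : Equiv.Perm A) '' X) ⊆ (leastSupp X).image (g : Equiv.Perm A) :=
  leastSupp_subset ((cutInvariant_image_iff g).2 (cutInvariant_leastSupp h))

/-- The reverse inclusion comes from the one already known, applied to `g⁻¹` and the image of `X`.
-/
theorem leastSupp_image (g : orderPermGroup A) {X : Set A} (h : ∃ E, CutInvariant E X) :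
    leastSupp ((g : Equiv.Perm A) '' X) = (leastSupp X).image (g : Equiv.Perm A) := by
  refine (leastSupp_image_subset g h).antisymm ?_
  have := leastSupp_image_subset g⁻¹ (X := (g : Equiv.Perm A) '' X)
    (h.imp' _ fun E => (cutInvariant_image_iff g).2)
  rw [Set.image_image] at this
  have := Finset.image_subset_image (f := (g : Equiv.Perm A)) this
  simpa [Finset.image_image, Function.comp_def] using this

end

/-! ### Numbering cut classes and counting their unions -/

/-- The number of the cut class of `a` in the increasing enumeration of the cut classes of `E`. -/
def cutIndex (E : Finset A) (a : A) : ℕ := (E.filter (· < a)).card + (E.filter (· ≤ a)).card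

theorem cutIndex_lt (E : Finset A) (a : A) : cutIndex E a < 2 * E.card + 1 := by
  have h1 := Finset.card_filter_le E (· < a)
  have h2 := Finset.card_filter_le E (· ≤ a)
  rw [cutIndex]
  omega

/-- Both counts in `cutIndex` are monotone in the point, so equal sums force equal counts, hence
equal filtered sets. -/
theorem sameCut_of_cutIndex_eq {E : Finset A} {a b : A} (h : cutIndex E a = cutIndex E b) :
    SameCut E a b := by
  wlog hab : a ≤ b
  · exact (this h.symm (le_of_not_ge hab)).symm
  have s1 : E.filter (· < a) ⊆ E.filter (· < b) :=
    Finset.monotone_filter_right E fun e _ he => lt_of_lt_of_le he hab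
  have s2 : E.filter (· ≤ a) ⊆ E.filter (· ≤ b) :=
    Finset.monotone_filter_right E fun e _ he => le_trans he hab
  have c1 := Finset.card_le_card s1
  have c2 := Finset.card_le_card s2
  rw [cutIndex, cutIndex] at h
  have e1 := Finset.eq_of_subset_of_card_le s1 (by omega)
  have e2 := Finset.eq_of_subset_of_card_le s2 (by omega)
  intro e he
  have t1 := Finset.ext_iff.1 e1 e
  have t2 := Finset.ext_iff.1 e2 e
  simp only [Finset.mem_filter, he, true_and] at t1 t2
  exact ⟨t1, t2⟩

theorem cutIndex_image (g : orderPermGroup A) (E : Finset A) (a : A) :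
    cutIndex (E.image (g : Equiv.Perm A)) ((g : Equiv.Perm A) a) = cutIndex E a := by
  have h := strictMono_of_orderPermGroup g
  simp only [cutIndex, Finset.filter_image, h.lt_iff_lt, h.le_iff_le,
    Finset.card_image_of_injective _ (g : Equiv.Perm A).injective]

open scoped Classical in
/-- The set of numbers of the cut classes of `E` which meet `X`. -/
noncomputable def cutPattern (E : Finset A) (X : Set A) : Finset ℕ :=
  {k ∈ Finset.range (2 * E.card + 1) | ∃ a ∈ X, cutIndex E a = k}

theorem cutPattern_mem (E : Finset A) (X : Set A) :
    cutPattern E X ∈ (Finset.range (2 * E.card + 1)).powerset := by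
  classical
  exact Finset.mem_powerset.2 (Finset.filter_subset _ _)

theorem CutInvariant.mem_iff {E : Finset A} {X : Set A} (h : CutInvariant E X) (a : A) :
    a ∈ X ↔ cutIndex E a ∈ cutPattern E X := by
  simp only [cutPattern, Finset.mem_filter, Finset.mem_range, cutIndex_lt, true_and]
  exact ⟨fun ha => ⟨a, ha, rfl⟩, fun ⟨b, hb, e⟩ => (h _ _ (sameCut_of_cutIndex_eq e)).1 hb⟩

theorem CutInvariant.eq_of_cutPattern_eq {E : Finset A} {X Y : Set A} (hX : CutInvariant E X)
    (hY : CutInvariant E Y) (h : cutPattern E X = cutPattern E Y) : X = Y :=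
  Set.ext fun a => by rw [hX.mem_iff, hY.mem_iff, h]

/-- The pattern depends only on the order, so it may be coded by an arbitrarily chosen map without
losing symmetry. -/
theorem cutPattern_image (g : orderPermGroup A) (E : Finset A) (X : Set A) :
    cutPattern (E.image (g : Equiv.Perm A)) ((g : Equiv.Perm A) '' X) = cutPattern E X := by
  ext k
  simp only [cutPattern, Finset.mem_filter, Set.exists_mem_image, cutIndex_image,
    Finset.card_image_of_injective _ (g : Equiv.Perm A).injective]

theorem encard_cutInvariant_le (E : Finset A) :
    {X : Set A | CutInvariant E X}.encard ≤ (2 ^ (2 * E.card + 1) : ℕ) := by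
  have : Set.InjOn (cutPattern E) {X : Set A | CutInvariant E X} :=
    fun X hX Y hY h => hX.eq_of_cutPattern_eq hY h
  rw [← this.encard_image]
  refine (Set.encard_le_encard (t := ((Finset.range (2 * E.card + 1)).powerset : Set (Finset ℕ)))
    ?_).trans ?_
  · rintro _ ⟨X, -, rfl⟩
    exact cutPattern_mem E X
  · rw [Set.encard_coe_eq_coe_finsetCard, Finset.card_powerset, Finset.card_range]

/-! ### Enumerations of finite sets -/

/-- Ten is the first value that works. Each step multiplies the left side by 4 and the right side by
`n + 1`. -/
theorem two_pow_lt_factorial {n : ℕ} (hn : 10 ≤ n) : 2 ^ (2 * n + 1) < n.factorial := by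
  induction n, hn using Nat.le_induction with
  | base => decide
  | succ n hn ih =>
    rw [Nat.factorial_succ, show 2 * (n + 1) + 1 = (2 * n + 1) + 2 by ring, pow_add]
    nlinarith

/-- The enumeration of `E` obtained from the increasing one by a permutation of the indices. -/
def permList (E : Finset A) {n : ℕ} (h : E.card = n) (σ : Equiv.Perm (Fin n)) : List A :=
  List.ofFn fun i => E.orderEmbOfFin h (σ i)

theorem mem_permList {E : Finset A} {n : ℕ} (h : E.card = n) (σ : Equiv.Perm (Fin n)) (a : A) :
    a ∈ permList E h σ ↔ a ∈ E := by
  rw [permList, List.mem_ofFn', ← Finset.mem_coe, ← Finset.range_orderEmbOfFin E h]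
  exact Set.ext_iff.1 (σ.surjective.range_comp _) a

theorem nodup_permList {E : Finset A} {n : ℕ} (h : E.card = n) (σ : Equiv.Perm (Fin n)) :
    (permList E h σ).Nodup :=
  List.nodup_ofFn.2 ((E.orderEmbOfFin h).injective.comp σ.injective)

theorem permList_injective {E : Finset A} {n : ℕ} (h : E.card = n) :
    Function.Injective (permList E h) := fun _ _ e =>
  Equiv.ext fun i => (E.orderEmbOfFin h).injective (congrFun (List.ofFn_injective e) i)

/-- An order-preserving map carries the increasing enumeration of `E` to that of its image, by
uniqueness of the latter. -/
theorem map_permList (g : orderPermGroup A) {E E' : Finset A} {n : ℕ} (h : E.card = n)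
    (h' : E'.card = n) (hE : E' = E.image (g : Equiv.Perm A)) (σ : Equiv.Perm (Fin n)) :
    (permList E h σ).map (g : Equiv.Perm A) = permList E' h' σ := by
  rw [permList, permList, List.map_ofFn,
    ← Finset.orderEmbOfFin_unique h' (f := (g : Equiv.Perm A) ∘ E.orderEmbOfFin h) (fun i => ?_)
      ((strictMono_of_orderPermGroup g).comp (E.orderEmbOfFin h).strictMono)]
  · rfl
  · rw [hE]
    exact Finset.mem_image_of_mem _ (Finset.orderEmbOfFin_mem _ _ _)

theorem factorial_le_encard_nodup (E : Finset A) :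
    (E.card.factorial : ℕ∞) ≤ {l : List A | l.Nodup ∧ ∀ a ∈ l, a ∈ E}.encard := by
  have h := (permList_injective (rfl : E.card = E.card)).injOn (s := Set.univ)
  refine le_trans ?_ (Set.encard_le_encard (s := permList E rfl '' Set.univ) ?_)
  · rw [h.encard_image, Set.encard_univ, ENat.card_eq_coe_fintype_card, Fintype.card_perm,
      Fintype.card_fin]
  · rintro _ ⟨σ, -, rfl⟩
    exact ⟨nodup_permList _ σ, fun a => (mem_permList _ σ a).1⟩

theorem finite_nodup_lists {α : Type*} (E : Finset α) :
    {l : List α | l.Nodup ∧ ∀ a ∈ l, a ∈ E}.Finite := by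
  classical
  refine (Set.finite_range fun l : {l : List E // l.Nodup} => l.1.map Subtype.val).subset ?_
  rintro l ⟨hl, h⟩
  lift l to List E using h
  exact ⟨⟨l, hl.of_map _⟩, rfl⟩

theorem infinite_lists {α : Type*} {E : Finset α} (h : E.Nonempty) :
    {l : List α | ∀ a ∈ l, a ∈ E}.Infinite := by
  obtain ⟨e, he⟩ := h
  refine Set.infinite_of_injective_forall_mem (f := fun n => List.replicate n e)
    (fun m n h => by simpa using congrArg List.length h) fun n a ha => ?_
  rwa [List.eq_of_mem_replicate ha]

theorem exists_permCode (n : ℕ) : ∃ j : Finset ℕ → Equiv.Perm (Fin n), 10 ≤ n →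
    Set.InjOn j ((Finset.range (2 * n + 1)).powerset : Finset (Finset ℕ)) := by
  classical
  by_cases hn : 10 ≤ n
  · have hcard : Fintype.card (Finset.range (2 * n + 1)).powerset ≤
        Fintype.card (Equiv.Perm (Fin n)) := by
      rw [Fintype.card_coe, Finset.card_powerset, Finset.card_range, Fintype.card_perm,
        Fintype.card_fin]
      exact (two_pow_lt_factorial hn).le
    obtain ⟨j⟩ := Function.Embedding.nonempty_of_card_le hcard
    obtain ⟨j, hj⟩ := Set.exists_injOn_iff_injective.2 ⟨_, j.injective⟩
    exact ⟨j, fun _ => hj⟩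
  -- Below ten the map is a dummy; nothing is claimed about it.
  · exact ⟨fun _ => 1, fun h => (hn h).elim⟩

/-- An injective coding of patterns by permutations. -/
noncomputable def permCode (n : ℕ) : Finset ℕ → Equiv.Perm (Fin n) := (exists_permCode n).choose

theorem permCode_injOn {n : ℕ} (hn : 10 ≤ n) :
    Set.InjOn (permCode n) ((Finset.range (2 * n + 1)).powerset : Finset (Finset ℕ)) :=
  (exists_permCode n).choose_spec hn

/-- The enumeration of `E` which codes the subset `X`. -/
noncomputable def subsetCode (E : Finset A) (X : Set A) : List A :=
  permList E rfl (permCode _ (cutPattern E X))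

theorem map_subsetCode (g : orderPermGroup A) (E : Finset A) (X : Set A) :
    (subsetCode E X).map (g : Equiv.Perm A) =
      subsetCode (E.image (g : Equiv.Perm A)) ((g : Equiv.Perm A) '' X) := by
  have hc := Finset.card_image_of_injective E (g : Equiv.Perm A).injective
  -- Transports the code along the equality of the cardinalities of `E` and its image, on which its
  -- type depends.
  have : ∀ n (h : (E.image (g : Equiv.Perm A)).card = n) p,
      permList (E.image (g : Equiv.Perm A)) rfl (permCode _ p) =
        permList _ h (permCode n p) := by
    rintro _ rfl p
    rfl
  rw [subsetCode, subsetCode, cutPattern_image, this _ hc, map_permList g rfl hc rfl]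

/-- Decoding: the entries of the list give back the support, their arrangement gives the
permutation, and this gives the pattern. -/
theorem eq_of_subsetCode_eq {E E' : Finset A} {X Y : Set A} (hE : 10 ≤ E.card)
    (hX : CutInvariant E X) (hY : CutInvariant E' Y) (h : subsetCode E X = subsetCode E' Y) :
    X = Y := by
  obtain rfl : E = E' := by
    ext a
    rw [← mem_permList rfl (permCode _ (cutPattern E X)),
      ← mem_permList rfl (permCode _ (cutPattern E' Y))]
    exact iff_of_eq (congrArg (a ∈ ·) h)
  exact hX.eq_of_cutPattern_eq hY (permCode_injOn hE (cutPattern_mem E X) (cutPattern_mem E Y)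
    (permList_injective rfl h))

end

/-! ### Finiteness, and lists of atoms as sequences of the model -/

namespace PermModel

section

variable {A : Type u} {G : Subgroup (Equiv.Perm A)}

theorem CardEq.finite {x y : PermModel G} (h : CardEq x y) (hx : {u | u ∈ x}.Finite) :
    {v | v ∈ y}.Finite := by
  obtain ⟨f, hf⟩ := h
  obtain ⟨⟨hfun, -⟩, hsurj⟩ := (isBijection_iff.1 hf).imp_left isInjection_iff.1
  obtain ⟨-, hdom, hval⟩ := isFunction_iff.1 hfun
  have : Nonempty (PermModel G) := ⟨x⟩
  choose! F _ hF' using hval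
  refine (hx.image F).subset fun v hv => ?_
  obtain ⟨u, huv⟩ := hsurj v hv
  obtain ⟨u', v', hu, -, e⟩ := hdom _ huv
  obtain ⟨rfl, rfl⟩ := opair_inj.1 e
  exact ⟨u, hu, (hF' u hu v huv).symm⟩

theorem IsFinite.finite {x : PermModel G} (h : IsFinite x) : {v | v ∈ x}.Finite := by
  obtain ⟨_, hn, h⟩ := h
  obtain ⟨n, rfl⟩ := isNat_iff.1 hn
  refine h.finite (((Set.finite_lt_nat n).image nat).subset fun z hz => ?_)
  obtain ⟨i, hi, rfl⟩ := mem_nat.1 hz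
  exact ⟨i, hi, rfl⟩

theorem isSymmFamily_atom : IsSymmFamily (atom : A → PermModel G) :=
  ⟨∅, fun g _ a => ⟨(g : Equiv.Perm A) a, rfl⟩⟩

variable (G) in
/-- The set of all atoms. -/
noncomputable def atomSet : PermModel G := range atom isSymmFamily_atom

theorem mem_atomSet {x : PermModel G} : x ∈ atomSet G ↔ ∃ a, x = atom a := mem_range

theorem atom_mem_atomSet (a : A) : atom a ∈ atomSet G := mem_atomSet.2 ⟨a, rfl⟩

theorem isAtomSet_iff {x : PermModel G} : IsAtomSet x ↔ x = atomSet G := by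
  rw [atomSet, eq_range_iff, IsAtomSet]
  simp only [isAtom_iff]

/-- The finite sequence of atoms given by a list. -/
noncomputable def seqObj (l : List A) : PermModel G :=
  graph (fun i : ULift.{u} (Fin l.length) => nat i.down) (fun i => atom (l.get i.down))
    (.of_finite _)

theorem nat_down_injective (n : ℕ) :
    Function.Injective fun i : ULift.{u} (Fin n) => (nat i.down : PermModel G) :=
  fun _ _ h => ULift.ext _ _ (Fin.ext (nat_injective h))

theorem mem_nat_iff_down {n : ℕ} {z : PermModel G} :
    z ∈ (nat n : PermModel G) ↔ ∃ i : ULift.{u} (Fin n), z = nat i.down :=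
  mem_nat.trans ⟨fun ⟨i, hi, h⟩ => ⟨⟨⟨i, hi⟩⟩, h⟩, fun ⟨i, h⟩ => ⟨_, i.down.isLt, h⟩⟩

theorem mem_seqObj {l : List A} {z : PermModel G} :
    z ∈ (seqObj l : PermModel G) ↔ ∃ n a, l[n]? = some a ∧ z = opair (nat n) (atom a) := by
  rw [seqObj, graph, mem_range]
  constructor
  · rintro ⟨i, rfl⟩
    exact ⟨i.down, l.get i.down, by simp, rfl⟩
  · rintro ⟨n, a, h, rfl⟩
    obtain ⟨hn, rfl⟩ := List.getElem?_eq_some_iff.1 h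
    exact ⟨⟨⟨n, hn⟩⟩, rfl⟩

theorem opair_mem_seqObj {l : List A} {n : ℕ} {a : A} :
    opair (nat n) (atom a) ∈ (seqObj l : PermModel G) ↔ l[n]? = some a := by
  rw [mem_seqObj]
  constructor
  · rintro ⟨m, b, h, e⟩
    obtain ⟨h1, h2⟩ := opair_inj.1 e
    rwa [nat_injective h1, atom_injective h2]
  · exact fun h => ⟨n, a, h, rfl⟩

theorem isSet_seqObj (l : List A) : IsSet (seqObj l : PermModel G) := by
  rw [seqObj, graph]
  exact isSet_range _ _

theorem seqObj_injective : Function.Injective (seqObj : List A → PermModel G) := fun l l' h =>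
  List.ext_getElem? fun n => Option.ext fun a => by
    rw [← opair_mem_seqObj (G := G), ← opair_mem_seqObj (G := G), h]

theorem smul_seqObj (g : G) (l : List A) :
    g • (seqObj l : PermModel G) = seqObj (l.map (g : Equiv.Perm A)) := by
  refine ext ((isSet_smul_iff g).2 (isSet_seqObj l)) (isSet_seqObj _) fun z => ?_
  rw [mem_smul_iff, mem_seqObj, mem_seqObj]
  simp only [inv_smul_eq_iff, smul_opair, smul_nat, smul_atom, List.getElem?_map,
    Option.map_eq_some_iff]
  constructor
  · rintro ⟨n, a, h, e⟩
    exact ⟨n, _, ⟨a, h, rfl⟩, e⟩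
  · rintro ⟨n, _, ⟨a, h, rfl⟩, e⟩
    exact ⟨n, a, h, e⟩

theorem isFunction_seqObj (l : List A) :
    IsFunction (seqObj l : PermModel G) (nat l.length) (atomSet G) :=
  (isFunction_graph_iff (nat_down_injective _) fun _ => mem_nat_iff_down).2 fun _ =>
    atom_mem_atomSet _

theorem isInjection_seqObj_iff {l : List A} {y : PermModel G} :
    IsInjection (seqObj l) (nat l.length) y ↔ (∀ a ∈ l, atom a ∈ y) ∧ l.Nodup := by
  rw [seqObj, isInjection_graph_iff (nat_down_injective _) fun _ => mem_nat_iff_down]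
  refine and_congr ⟨fun h a ha => ?_, fun h i => h _ (List.get_mem _ _)⟩ ?_
  · obtain ⟨i, rfl⟩ := List.get_of_mem ha
    exact h ⟨i⟩
  · rw [List.nodup_iff_injective_get]
    exact ⟨fun h i j e => congrArg ULift.down (@h ⟨i⟩ ⟨j⟩ (congrArg atom e)),
      fun h i j e => ULift.ext _ _ (h (atom_injective e))⟩

/-- The values of `s` at the standard numbers below `n` are read off externally, and extensionality
does the rest. -/
theorem exists_eq_seqObj {s : PermModel G} {n : ℕ} (h : IsFunction s (nat n) (atomSet G)) :
    ∃ l : List A, l.length = n ∧ s = seqObj l := by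
  obtain ⟨hs, hdom, hval⟩ := isFunction_iff.1 h
  have hex : ∀ i : Fin n, ∃ a : A, opair (nat i) (atom a) ∈ s ∧
      ∀ v, opair (nat i) v ∈ s → v = atom a := by
    intro i
    obtain ⟨v, hv, huniq⟩ := hval (nat i) (nat_mem_nat.2 i.isLt)
    obtain ⟨_, v', -, hv', e⟩ := hdom _ hv
    obtain ⟨-, rfl⟩ := opair_inj.1 e
    obtain ⟨a, rfl⟩ := mem_atomSet.1 hv'
    exact ⟨a, hv, huniq⟩
  choose F hF hF' using hex
  refine ⟨List.ofFn F, List.length_ofFn, ext hs (isSet_seqObj _) fun z => ?_⟩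
  rw [mem_seqObj]
  simp only [List.getElem?_eq_some_iff, List.length_ofFn, List.getElem_ofFn]
  constructor
  · intro hz
    obtain ⟨u, v, hu, -, rfl⟩ := hdom _ hz
    obtain ⟨i, hi, rfl⟩ := mem_nat.1 hu
    exact ⟨i, _, ⟨hi, rfl⟩, by rw [← hF' ⟨i, hi⟩ v hz]⟩
  · rintro ⟨i, _, ⟨hi, rfl⟩, rfl⟩
    exact hF ⟨i, hi⟩

theorem isSymmFamily_seqObj : IsSymmFamily (seqObj : List A → PermModel G) :=
  ⟨∅, fun g _ l => ⟨l.map (g : Equiv.Perm A), smul_seqObj g l⟩⟩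

theorem isSymmFamily_seqObj_nodup :
    IsSymmFamily fun l : {l : List A // l.Nodup} => (seqObj l.1 : PermModel G) :=
  ⟨∅, fun g _ l => ⟨⟨l.1.map (g : Equiv.Perm A), l.2.map (g : Equiv.Perm A).injective⟩,
    smul_seqObj g l.1⟩⟩

theorem isSeq_iff {x : PermModel G} :
    IsSeq x (atomSet G) ↔ x = range seqObj isSymmFamily_seqObj := by
  rw [eq_range_iff, IsSeq]
  refine and_congr_right fun _ => forall_congr' fun z => iff_congr Iff.rfl ?_
  simp only [isNat_iff]
  constructor
  · rintro ⟨_, ⟨n, rfl⟩, h⟩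
    obtain ⟨l, -, e⟩ := exists_eq_seqObj h
    exact ⟨l, e⟩
  · rintro ⟨l, rfl⟩
    exact ⟨_, ⟨_, rfl⟩, isFunction_seqObj l⟩

theorem isInjSeq_iff {x : PermModel G} :
    IsInjSeq x (atomSet G) ↔ x = range _ isSymmFamily_seqObj_nodup := by
  rw [eq_range_iff, IsInjSeq]
  refine and_congr_right fun _ => forall_congr' fun z => iff_congr Iff.rfl ?_
  simp only [isNat_iff]
  constructor
  · rintro ⟨_, ⟨n, rfl⟩, h⟩
    obtain ⟨l, rfl, rfl⟩ := exists_eq_seqObj h.1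
    exact ⟨⟨l, (isInjection_seqObj_iff.1 h).2⟩, rfl⟩
  · rintro ⟨l, rfl⟩
    exact ⟨_, ⟨_, rfl⟩, isInjection_seqObj_iff.2 ⟨fun a _ => atom_mem_atomSet a, l.2⟩⟩

end

/-! ### Sets of atoms as objects of the Mostowski model -/

section

variable {A : Type u} [LinearOrder A]

theorem isSymmFamily_atom_coe {X : Set A} (hX : ∃ E, CutInvariant E X) :
    IsSymmFamily fun a : X => (atom a.1 : MostowskiModel A) :=
  hX.imp fun _ hE _ hg a => ⟨⟨_, (hE _ _ (sameCut_of_fixes hg a.1)).1 a.2⟩, rfl⟩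

/-- A finitely supported set of atoms, as an object of the model. -/
noncomputable def setObj (X : {X : Set A // ∃ E, CutInvariant E X}) : MostowskiModel A :=
  range (fun a : X.1 => atom a.1) (isSymmFamily_atom_coe X.2)

theorem mem_setObj {X : {X : Set A // ∃ E, CutInvariant E X}} {z : MostowskiModel A} :
    z ∈ setObj X ↔ ∃ a ∈ X.1, z = atom a := by
  rw [setObj, mem_range, Subtype.exists]
  simp only [exists_prop]

theorem atom_mem_setObj {X : {X : Set A // ∃ E, CutInvariant E X}} {a : A} :
    atom a ∈ setObj X ↔ a ∈ X.1 := by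
  simp only [mem_setObj, atom_injective.eq_iff, exists_eq_right']

theorem isSet_setObj (X : {X : Set A // ∃ E, CutInvariant E X}) : IsSet (setObj X) :=
  isSet_range _ _

theorem setObj_injective : Function.Injective (setObj : _ → MostowskiModel A) := fun X Y h =>
  Subtype.ext <| Set.ext fun a => by rw [← atom_mem_setObj, h, atom_mem_setObj]

/-- The image of a finitely supported set of atoms. -/
def imageSet (g : orderPermGroup A) (X : {X : Set A // ∃ E, CutInvariant E X}) :
    {X : Set A // ∃ E, CutInvariant E X} :=
  ⟨(g : Equiv.Perm A) '' X.1, X.2.imp' _ fun _ => (cutInvariant_image_iff g).2⟩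

theorem smul_setObj (g : orderPermGroup A) (X : {X : Set A // ∃ E, CutInvariant E X}) :
    g • setObj X = setObj (imageSet g X) :=
  ext ((isSet_smul_iff g).2 (isSet_setObj X)) (isSet_setObj _) fun z => by
    rw [mem_smul_iff, mem_setObj, mem_setObj]
    simp only [inv_smul_eq_iff, smul_atom, imageSet, Set.exists_mem_image]

theorem isSymmFamily_setObj : IsSymmFamily (setObj : _ → MostowskiModel A) :=
  ⟨∅, fun g _ X => ⟨imageSet g X, smul_setObj g X⟩⟩

theorem encard_supports_range {ι : Type u} {f : ι → MostowskiModel A} (hf : IsSymmFamily f)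
    (hinj : Function.Injective f) (E : Finset A) :
    {u | u ∈ range f hf ∧ Supports (G := orderPermGroup A) E u}.encard = {i | Supports (G := orderPermGroup A) E (f i)}.encard := by
  rw [← hinj.encard_image]
  congr 1
  ext u
  simp only [mem_range, Set.mem_ofPred_eq, Set.mem_image]
  constructor
  · rintro ⟨⟨i, rfl⟩, h⟩
    exact ⟨i, h, rfl⟩
  · rintro ⟨i, h, rfl⟩
    exact ⟨⟨i, rfl⟩, h⟩

variable [DenselyOrdered A] [NoMinOrder A]

/-- A finite set of atoms. -/
def coeSet (s : Finset A) : {X : Set A // ∃ E, CutInvariant E X} :=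
  ⟨s, s, cutInvariant_coe_iff.2 subset_rfl⟩

theorem coeSet_injective : Function.Injective (coeSet : Finset A → _) := fun _ _ h =>
  Finset.coe_injective (congrArg Subtype.val h)

theorem imageSet_coeSet (g : orderPermGroup A) (s : Finset A) :
    imageSet g (coeSet s) = coeSet (s.image (g : Equiv.Perm A)) :=
  Subtype.ext Finset.coe_image.symm

theorem smul_setObj_coeSet (g : orderPermGroup A) (s : Finset A) :
    g • setObj (coeSet s) = setObj (coeSet (s.image (g : Equiv.Perm A))) := by
  rw [smul_setObj, imageSet_coeSet]

theorem isSymmFamily_setObj_coeSet :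
    IsSymmFamily fun s : Finset A => (setObj (coeSet s) : MostowskiModel A) :=
  ⟨∅, fun g _ s => ⟨s.image (g : Equiv.Perm A), smul_setObj_coeSet g s⟩⟩

/-- Every list of atoms is a sequence of the model, so an arbitrary enumeration of `s` is a
bijection of the model. -/
theorem isFinite_setObj_coeSet (s : Finset A) : IsFinite (setObj (coeSet s)) := by
  refine ⟨nat s.toList.length, isNat_iff.2 ⟨_, rfl⟩, seqObj s.toList,
    isBijection_iff.2 ⟨isInjection_seqObj_iff.2 ⟨fun a ha => ?_, s.nodup_toList⟩, fun v hv => ?_⟩⟩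
  · exact atom_mem_setObj.2 (Finset.mem_toList.1 ha)
  · obtain ⟨a, ha, rfl⟩ := mem_setObj.1 hv
    obtain ⟨n, hn⟩ := List.mem_iff_getElem?.1 (Finset.mem_toList.2 ha)
    exact ⟨nat n, opair_mem_seqObj.2 hn⟩

theorem supports_atom_iff [Countable A] [NoMaxOrder A] {E : Finset A} {a : A} :
    Supports (G := orderPermGroup A) E (atom a : MostowskiModel A) ↔ a ∈ E := by
  constructor
  · intro h
    by_contra ha
    obtain ⟨b, hb, hab⟩ := exists_ne_sameCut ha
    obtain ⟨g, hg, rfl⟩ := exists_fixes_apply_eq hab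
    exact hb (atom_injective (h g hg))
  · exact fun ha g hg => congrArg atom (hg a ha)

theorem supports_seqObj_iff [Countable A] [NoMaxOrder A] {E : Finset A} {l : List A} :
    Supports (G := orderPermGroup A) E (seqObj l : MostowskiModel A) ↔ ∀ a ∈ l, a ∈ E := by
  have hiff : Supports (G := orderPermGroup A) E (seqObj l : MostowskiModel A) ↔
      ∀ a ∈ l, Supports (G := orderPermGroup A) E (atom a : MostowskiModel A) := by
    have hmap : ∀ f : A → A, l.map f = l ↔ ∀ a ∈ l, f a = a := fun f => by
      simpa using List.map_inj_left (f := f) (g := id) (l := l)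
    simp only [Supports, smul_seqObj, seqObj_injective.eq_iff, smul_atom, atom_injective.eq_iff,
      hmap]
    exact ⟨fun h a ha g hg => h g hg a ha, fun h g hg a ha => h a ha g hg⟩
  simp only [hiff, supports_atom_iff]

theorem supports_setObj_iff [Countable A] [NoMaxOrder A] {E : Finset A}
    {X : {X : Set A // ∃ E, CutInvariant E X}} :
    Supports (G := orderPermGroup A) E (setObj X) ↔ CutInvariant E X.1 := by
  rw [cutInvariant_iff_image_eq]
  refine forall₂_congr fun g _ => ?_
  rw [smul_setObj, setObj_injective.eq_iff]
  exact Subtype.ext_iff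

/-- A support of `x` is a set `E` for which the atoms of `x` form a union of cut classes. -/
theorem isSubset_atomSet_iff [Countable A] [NoMaxOrder A] {x : MostowskiModel A} :
    IsSubset x (atomSet _) ↔ ∃ X, x = setObj X := by
  constructor
  · rintro ⟨hx, h⟩
    obtain ⟨E, hE⟩ := exists_supports x
    refine ⟨⟨{a | atom a ∈ x}, E, cutInvariant_iff_image_eq.2 fun g hg => ?_⟩,
      ext hx (isSet_setObj _) fun z => ?_⟩
    · ext a
      rw [Equiv.image_eq_preimage_symm]
      change g⁻¹ • (atom a : MostowskiModel A) ∈ x ↔ atom a ∈ x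
      rw [← mem_smul_iff, hE g hg]
    · rw [mem_setObj]
      constructor
      · intro hz
        obtain ⟨a, rfl⟩ := mem_atomSet.1 (h z hz)
        exact ⟨a, hz, rfl⟩
      · rintro ⟨a, ha, rfl⟩
        exact ha
  · rintro ⟨X, rfl⟩
    refine ⟨isSet_setObj X, fun z hz => ?_⟩
    obtain ⟨a, -, rfl⟩ := mem_setObj.1 hz
    exact atom_mem_atomSet a

theorem isPowerset_iff [Countable A] [NoMaxOrder A] {x : MostowskiModel A} :
    IsPowerset x (atomSet _) ↔ x = range setObj isSymmFamily_setObj := by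
  rw [eq_range_iff, IsPowerset]
  simp only [isSubset_atomSet_iff]

theorem isFin_iff [Countable A] [NoMaxOrder A] {x : MostowskiModel A} :
    IsFin x (atomSet _) ↔ x = range _ isSymmFamily_setObj_coeSet := by
  rw [eq_range_iff, IsFin]
  refine and_congr_right fun _ => forall_congr' fun z => iff_congr Iff.rfl ?_
  rw [isSubset_atomSet_iff]
  constructor
  · rintro ⟨⟨X, rfl⟩, h⟩
    have hX : X.1.Finite := (h.finite.preimage atom_injective.injOn).subset fun a ha =>
      atom_mem_setObj.2 ha
    exact ⟨hX.toFinset, congrArg setObj (Subtype.ext hX.coe_toFinset.symm)⟩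
  · rintro ⟨s, rfl⟩
    exact ⟨⟨_, rfl⟩, isFinite_setObj_coeSet s⟩

/-! ### Counting the elements with a given support -/

section

variable [NoMaxOrder A]

theorem encard_supports_atomSet [Countable A] (E : Finset A) :
    {u | u ∈ atomSet (orderPermGroup A) ∧ Supports (G := orderPermGroup A) E u}.encard = E.card := by
  rw [atomSet, encard_supports_range _ atom_injective]
  simp only [supports_atom_iff]
  exact Set.encard_coe_eq_coe_finsetCard E

theorem encard_supports_fin [Countable A] (E : Finset A) :
    {u | u ∈ range _ (isSymmFamily_setObj_coeSet (A := A)) ∧ Supports (G := orderPermGroup A) E u}.encard =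
      (2 ^ E.card : ℕ) := by
  rw [encard_supports_range _ fun _ _ h => coeSet_injective (setObj_injective h)]
  simp only [supports_setObj_iff, coeSet, cutInvariant_coe_iff, ← Finset.mem_powerset]
  rw [← Finset.card_powerset]
  exact Set.encard_coe_eq_coe_finsetCard E.powerset

theorem encard_supports_powerset [Countable A] (E : Finset A) :
    {u | u ∈ range _ (isSymmFamily_setObj (A := A)) ∧ Supports (G := orderPermGroup A) E u}.encard =
      {X : Set A | CutInvariant E X}.encard := by
  rw [encard_supports_range _ setObj_injective]
  simp only [supports_setObj_iff]
  rw [← Subtype.val_injective.encard_image]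
  congr 1
  ext X
  exact ⟨fun ⟨Y, hY, e⟩ => e ▸ hY, fun h => ⟨⟨X, E, h⟩, h, rfl⟩⟩

theorem encard_supports_injSeq [Countable A] (E : Finset A) :
    {u | u ∈ range _ (isSymmFamily_seqObj_nodup (G := orderPermGroup A)) ∧
      Supports (G := orderPermGroup A) E u}.encard = {l : List A | l.Nodup ∧ ∀ a ∈ l, a ∈ E}.encard := by
  rw [encard_supports_range _ fun _ _ h => Subtype.ext (seqObj_injective h)]
  simp only [supports_seqObj_iff]
  rw [← Subtype.val_injective.encard_image]
  congr 1
  ext l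
  exact ⟨fun ⟨l', h, e⟩ => e ▸ ⟨l'.2, h⟩, fun h => ⟨⟨l, h.1⟩, h.2, rfl⟩⟩

theorem encard_supports_seq [Countable A] (E : Finset A) :
    {u | u ∈ range _ (isSymmFamily_seqObj (G := orderPermGroup A)) ∧
      Supports (G := orderPermGroup A) E u}.encard = {l : List A | ∀ a ∈ l, a ∈ E}.encard := by
  rw [encard_supports_range _ seqObj_injective]
  simp only [supports_seqObj_iff]

/-- The subsets of `E` are invariant, and so is the whole of `A`, which is infinite. Finiteness of
the family makes the inclusion strict in cardinality. -/
theorem two_pow_card_lt_encard_cutInvariant [Nonempty A] (E : Finset A) :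
    ((2 ^ E.card : ℕ) : ℕ∞) < {X : Set A | CutInvariant E X}.encard := by
  have hfin : {X : Set A | CutInvariant E X}.Finite :=
    Set.finite_of_encard_le_coe (encard_cutInvariant_le E)
  have heq : ((2 ^ E.card : ℕ) : ℕ∞) =
      ((fun s : Finset A => (s : Set A)) '' (E.powerset : Set (Finset A))).encard := by
    rw [Finset.coe_injective.encard_image, Set.encard_coe_eq_coe_finsetCard, Finset.card_powerset]
  rw [heq]
  refine (hfin.subset ?_).encard_lt_encard (Set.ssubset_iff_subset_ne.2 ⟨?_, fun h => ?_⟩)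
  · rintro _ ⟨s, hs, rfl⟩
    exact cutInvariant_coe_iff.2 (Finset.mem_powerset.1 hs)
  · rintro _ ⟨s, hs, rfl⟩
    exact cutInvariant_coe_iff.2 (Finset.mem_powerset.1 hs)
  · have : (Set.univ : Set A) ∈ {X : Set A | CutInvariant E X} := fun _ _ _ => Iff.rfl
    rw [← h] at this
    obtain ⟨s, -, hs⟩ := this
    have : Infinite A := NoMaxOrder.infinite
    exact Set.infinite_univ (by rw [← hs]; exact s.finite_toSet)

/-! ### The comparisons of cardinalities -/

theorem atomSet_cardLT_fin [Countable A] :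
    CardLT (atomSet (orderPermGroup A)) (range _ isSymmFamily_setObj_coeSet) := by
  refine ⟨cardLE_of_family (u := atom) (v := fun a => setObj (coeSet {a})) atom_injective
    (fun a b h => Finset.singleton_injective (coeSet_injective (setObj_injective h)))
    (fun _ => mem_atomSet) (fun a => mem_range.2 ⟨_, rfl⟩) ∅
    fun g _ a => ⟨(g : Equiv.Perm A) a, smul_atom g a, ?_⟩, fun h => ?_⟩
  · rw [smul_setObj_coeSet, Finset.image_singleton]
  · obtain ⟨E, hE⟩ := h.encard_supports_eq
    have := hE E subset_rfl
    rw [encard_supports_atomSet, encard_supports_fin, Nat.cast_inj] at this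
    exact Nat.lt_two_pow_self.ne this

theorem fin_cardLT_powerset [Countable A] [Nonempty A] :
    CardLT (range _ (isSymmFamily_setObj_coeSet (A := A))) (range setObj isSymmFamily_setObj) := by
  refine ⟨cardLE_of_family (setObj_injective.comp coeSet_injective)
    (setObj_injective.comp coeSet_injective)
    (fun _ => mem_range) (fun a => mem_range.2 ⟨_, rfl⟩) ∅
    fun g _ s => ⟨_, smul_setObj_coeSet g s, smul_setObj_coeSet g s⟩, fun h => ?_⟩
  obtain ⟨E, hE⟩ := h.encard_supports_eq
  have := hE E subset_rfl
  rw [encard_supports_fin, encard_supports_powerset] at this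
  exact (two_pow_card_lt_encard_cutInvariant E).ne this

theorem powerset_cardLE_injSeq [Nonempty A] :
    CardLE (range _ (isSymmFamily_setObj (A := A))) (range _ isSymmFamily_seqObj_nodup) := by
  have : Infinite A := NoMaxOrder.infinite
  -- Padding least supports by `D` gives them at least ten elements; `D` then supports the injection
  -- itself.
  obtain ⟨D, hD⟩ := Infinite.exists_subset_card_eq A 10
  refine cardLE_of_family (u := setObj) (v := fun X => seqObj (subsetCode (leastSupp X.1 ∪ D) X.1))
    setObj_injective (fun X Y h => ?_) (fun _ => mem_range)
    (fun X => mem_range.2 ⟨⟨_, nodup_permList _ _⟩, rfl⟩) D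
    fun g hg X => ⟨imageSet g X, smul_setObj g X, ?_⟩
  · have hinv : ∀ X : {X : Set A // ∃ E, CutInvariant E X},
        CutInvariant (leastSupp X.1 ∪ D) X.1 := fun X =>
      (cutInvariant_leastSupp X.2).mono Finset.subset_union_left
    exact Subtype.ext (eq_of_subsetCode_eq (hD ▸ Finset.card_le_card Finset.subset_union_right)
      (hinv X) (hinv Y) (seqObj_injective h))
  · have hDg : D.image (g : Equiv.Perm A) = D := by
      rw [Finset.image_congr (g := id) fun a ha => hg a ha, Finset.image_id]
    simp only [imageSet]
    rw [smul_seqObj, map_subsetCode, Finset.image_union, hDg, leastSupp_image g X.2]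

theorem powerset_cardLT_injSeq [Countable A] [Nonempty A] :
    CardLT (range _ (isSymmFamily_setObj (A := A))) (range _ isSymmFamily_seqObj_nodup) := by
  refine ⟨powerset_cardLE_injSeq, fun h => ?_⟩
  have : Infinite A := NoMaxOrder.infinite
  obtain ⟨E, hE⟩ := h.encard_supports_eq
  obtain ⟨D, hD⟩ := Infinite.exists_subset_card_eq A 10
  -- The support of the alleged bijection is enlarged to at least ten atoms, where `n! ≤ 2 ^ (2 * n
  -- + 1)` fails.
  have := hE (E ∪ D) Finset.subset_union_left
  rw [encard_supports_powerset, encard_supports_injSeq] at this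
  have h1 := (factorial_le_encard_nodup _).trans (this.symm.le.trans (encard_cutInvariant_le _))
  exact (two_pow_lt_factorial (hD ▸ Finset.card_le_card Finset.subset_union_right)).not_ge
    (Nat.cast_le.1 h1)

theorem injSeq_cardLT_seq [Countable A] [Nonempty A] :
    CardLT (range _ (isSymmFamily_seqObj_nodup (G := orderPermGroup A)))
      (range _ isSymmFamily_seqObj) := by
  refine ⟨cardLE_of_family (seqObj_injective.comp Subtype.val_injective)
    (seqObj_injective.comp Subtype.val_injective)
    (fun _ => mem_range) (fun a => mem_range.2 ⟨_, rfl⟩) ∅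
    fun g _ l => ⟨⟨_, l.2.map (g : Equiv.Perm A).injective⟩, smul_seqObj g l.1,
      smul_seqObj g l.1⟩, fun h => ?_⟩
  obtain ⟨E, hE⟩ := h.encard_supports_eq
  obtain ⟨a⟩ := ‹Nonempty A›
  -- Adding `a` makes the support nonempty; over the empty set both sides have only the empty
  -- sequence.
  have := hE (insert a E) (Finset.subset_insert a E)
  rw [encard_supports_injSeq, encard_supports_seq,
    (infinite_lists (Finset.insert_nonempty a E)).encard_eq, Set.encard_eq_top_iff] at this
  exact this (finite_nodup_lists _)

end

end

end PermModel

theorem mainTheorem4 (A : Type u) [LinearOrder A] [Countable A] [Nonempty A] [DenselyOrdered A]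
    [NoMinOrder A] [NoMaxOrder A] :
    ∃ a F P S s : MostowskiModel A,
      (∀ x, x.IsAtomSet ↔ x = a) ∧
      (∀ x, x.IsFin a ↔ x = F) ∧
      (∀ x, x.IsPowerset a ↔ x = P) ∧
      (∀ x, x.IsInjSeq a ↔ x = S) ∧
      (∀ x, x.IsSeq a ↔ x = s) ∧
      a.CardLT F ∧ F.CardLT P ∧ P.CardLT S ∧ S.CardLT s :=
  ⟨_, _, _, _, _, fun _ => PermModel.isAtomSet_iff, fun _ => PermModel.isFin_iff,
    fun _ => PermModel.isPowerset_iff, fun _ => PermModel.isInjSeq_iff,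
    fun _ => PermModel.isSeq_iff, PermModel.atomSet_cardLT_fin, PermModel.fin_cardLT_powerset,
    PermModel.powerset_cardLT_injSeq, PermModel.injSeq_cardLT_seq⟩
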